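/- Let $\mathbb{F}\in\{\mathbb{R},\mathbb{C}\}$, with $\beta=1$ if $\mathbb{F}=\mathbb{R}$ and $\beta=2$ if $\mathbb{F}=\mathbb{C}$. Identify a matrix polynomial $A(x)=A_0+A_1x+\dots+A_dx^d$ with $A_k\in\mathbb{F}^{n\times n}$ with its vector of coefficients in $\mathbb{F}^N$, $N=n^2(d+1)$, and let $\|A\|$ be the Euclidean norm of this vector. Let $P(x)=P_0+\dots+P_dx^d$ be regular, that is, $\det P(x)\not\equiv 0$, and let $\lambda\in\mathbb{C}$ be a simple eigenvalue of $P(x)$, that is, a root of $\det P(x)$ of multiplicity one. Let $u,v\in\mathbb{C}^n$ be unit vectors with $u^*P(\lambda)=0$ and $P(\lambda)v=0$, and set $$\gamma_P=|u^*P'(\lambda)v|\Bigl(\sum_{j=0}^d|\lambda|^{2j}\Bigr)^{-1/2}.$$ Let $f$ be an input-output map for the problem of computing $\lambda$: $f(P)=\lambda$; for every direction $E(x)$ (of degree at most $d$, over $\mathbb{F}$) with $u^*E(\lambda)v\ne0$ and all sufficiently small $\epsilon>0$, $f(P+\epsilon E)$ is the eigenvalue of $P(x)+\epsilon E(x)$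 that converges to $\lambda$ as $\epsilon\to0^+$; the values of $f$ at other inputs are arbitrary. The directional sensitivity of $\lambda$ in direction $E$ is $$\sigma_E=\lim_{\epsilon\to0^+}\frac{|f(P+\epsilon E)-f(P)|}{\epsilon\|E\|}\in[0,\infty].$$ Then $\gamma_P>0$ and such maps $f$ exist. Moreover, let $E$ be a random matrix polynomial whose coefficient vector is uniformly distributed on the unit sphere $S^{\beta N-1}$ of $\mathbb{F}^N\cong\mathbb{R}^{\beta N}$. Then, for every such $f$, the limit defining $\sigma_E$ exists almost surely, and for all $0\le t\le\gamma_P^{-1}$, $$\mathbb{P}\{\sigma_E\ge t\}\le\exp\Bigl(-\frac{\beta(N-1)\gamma_P^2t^2}{2}\Bigr).$$ -/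

import Mathlib

open Polynomial MeasureTheory ProbabilityTheory Filter Topology Matrix
open scoped ENNReal

noncomputable section

namespace MatrixPolynomial

/-! ### Scalars: `𝕜` is `ℝ` or `ℂ` -/

/-- The inclusion of `𝕜 ∈ {ℝ, ℂ}` into `ℂ`, as a ring homomorphism. -/
def toComplex (𝕜 : Type*) [RCLike 𝕜] : 𝕜 →+* ℂ where
  toFun := RCLike.map 𝕜 ℂ
  map_zero' := map_zero _
  map_add' := map_add _
  map_one' := by simp [RCLike.map_apply]
  map_mul' := fun a b => by
    rcases RCLike.I_eq_zero_or_im_I_eq_one (K := 𝕜) with h | h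
    · have h0 : ∀ z : 𝕜, RCLike.im z = 0 := fun z => by
        have := RCLike.im_eq_zero h z
        simpa using this
      simp [RCLike.map_apply, h0]
    · exact map_mul (RCLike.complexRingEquiv h) a b

lemma toComplex_real (x : ℝ) : toComplex ℝ x = (x : ℂ) := by
  simp [toComplex]

lemma toComplex_complex (z : ℂ) : toComplex ℂ z = z := by
  simp [toComplex]

/-- `β = 1` for real and `β = 2` for complex perturbations. -/
def beta (𝕜 : Type*) [RCLike 𝕜] : ℕ := Module.finrank ℝ 𝕜

lemma beta_real : beta ℝ = 1 := by simp [beta]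

lemma beta_complex : beta ℂ = 2 := by simp [beta, Complex.finrank_real_complex]

/-! ### Matrix polynomials of degree at most `d` -/

/-- The space of `n × n` matrix polynomials `A(x) = A₀ + A₁ x + ⋯ + A_d x^d` over `𝕜`,
with the Euclidean norm of the vector of all `n² (d + 1)` coefficients;
`A (k, i, j)` is the `(i, j)` entry of `A_k`. -/
abbrev MatPoly (𝕜 : Type*) (n d : ℕ) : Type _ :=
  EuclideanSpace 𝕜 (Fin (d + 1) × Fin n × Fin n)

section

variable {𝕜 : Type*} [RCLike 𝕜] {n d : ℕ}

/-- The matrix with polynomial entries `A(x)`. -/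
def toMatrix (A : MatPoly 𝕜 n d) : Matrix (Fin n) (Fin n) 𝕜[X] :=
  Matrix.of fun i j => ∑ k : Fin (d + 1), monomial (k : ℕ) (A (k, i, j))

/-- The complex matrix `A(z)`, for `z ∈ ℂ`. -/
def evalAt (A : MatPoly 𝕜 n d) (z : ℂ) : Matrix (Fin n) (Fin n) ℂ :=
  (toMatrix A).map fun p => p.eval₂ (toComplex 𝕜) z

/-- The complex matrix `A'(z)`, for `z ∈ ℂ`. -/
def derivAt (A : MatPoly 𝕜 n d) (z : ℂ) : Matrix (Fin n) (Fin n) ℂ :=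
  (toMatrix A).map fun p => p.derivative.eval₂ (toComplex 𝕜) z

/-- `A(x)` is regular if `det A(x)` is not the zero polynomial. -/
def IsRegular (A : MatPoly 𝕜 n d) : Prop := (toMatrix A).det ≠ 0

/-- The rank of `A(x)` over the field of rational functions `𝕜(x)`. -/
def polyRank (A : MatPoly 𝕜 n d) : ℕ :=
  ((toMatrix A).map (algebraMap 𝕜[X] (RatFunc 𝕜))).rank

/-- `z ∈ ℂ` is a (finite) eigenvalue of `A(x)` if `rank A(z) < rank A(x)`. -/
def IsEigenvalue (A : MatPoly 𝕜 n d) (z : ℂ) : Prop := (evalAt A z).rank < polyRank A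

/-- A simple eigenvalue of a regular matrix polynomial: an eigenvalue that is a root of
multiplicity one of `det A(x)`. (Only meaningful for regular `A(x)`.) -/
def IsSimpleEigenvalue (A : MatPoly 𝕜 n d) (z : ℂ) : Prop :=
  IsEigenvalue A z ∧ ((toMatrix A).det.map (toComplex 𝕜)).rootMultiplicity z = 1

/-- `v ≠ 0` and `A(z) v = 0`. -/
def IsRightEigenvector (A : MatPoly 𝕜 n d) (z : ℂ) (v : EuclideanSpace ℂ (Fin n)) : Prop :=
  v ≠ 0 ∧ evalAt A z *ᵥ v.ofLp = 0

/-- `u ≠ 0` and `A(z)ᴴ u = 0`, that is, `uᴴ A(z) = 0`. -/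
def IsLeftEigenvector (A : MatPoly 𝕜 n d) (z : ℂ) (u : EuclideanSpace ℂ (Fin n)) : Prop :=
  u ≠ 0 ∧ (evalAt A z)ᴴ *ᵥ u.ofLp = 0

/-- The sesquilinear expression `uᴴ M v`. -/
def sesq (u : EuclideanSpace ℂ (Fin n)) (M : Matrix (Fin n) (Fin n) ℂ)
    (v : EuclideanSpace ℂ (Fin n)) : ℂ :=
  star u.ofLp ⬝ᵥ (M *ᵥ v.ofLp)

/-- `γ_P = |uᴴ P'(z) v| (∑_{j=0}^d |z|^{2j})^{-1/2}`, to be used with unit left and right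
eigenvectors `u`, `v` of the regular matrix polynomial `P(x)` for the simple eigenvalue `z`. -/
def gammaP (P : MatPoly 𝕜 n d) (z : ℂ) (u v : EuclideanSpace ℂ (Fin n)) : ℝ :=
  ‖sesq u (derivAt P z) v‖ / √(∑ j ∈ Finset.range (d + 1), ‖z‖ ^ (2 * j))

/-! ### The input-output map and the directional sensitivity -/

/-- The direction `E(x)` is nondegenerate for the regular matrix polynomial `P(x)` and its
simple eigenvalue `z`: `uᴴ E(z) v ≠ 0` for the left and right eigenvectors `u`, `v`. -/
def IsNondegenerateDirection (P : MatPoly 𝕜 n d) (z : ℂ) (E : MatPoly 𝕜 n d) : Prop :=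
  ∀ u v, IsLeftEigenvector P z u → IsRightEigenvector P z v → sesq u (evalAt E z) v ≠ 0

/-- `f` is an input-output map of the problem of computing the simple eigenvalue `z` of the
regular matrix polynomial `P(x)`: it sends `P(x)` to `z` and, in every nondegenerate direction
`E(x)` and for all small `ε > 0`, it sends `P(x) + ε E(x)` to the eigenvalue of `P(x) + ε E(x)`
that converges to `z` as `ε → 0`. Its values at all other inputs are arbitrary. -/
structure IsEigenvalueMap (P : MatPoly 𝕜 n d) (z : ℂ) (f : MatPoly 𝕜 n d → ℂ) : Prop where
  map_self : f P = z
  isEigenvalue : ∀ E, IsNondegenerateDirection P z E →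
    ∀ᶠ ε : ℝ in 𝓝[>] 0, IsEigenvalue (P + ε • E) (f (P + ε • E))
  tendsto : ∀ E, IsNondegenerateDirection P z E →
    Tendsto (fun ε : ℝ => f (P + ε • E)) (𝓝[>] 0) (𝓝 z)

end

section

variable {V W : Type*} [NormedAddCommGroup V] [NormedSpace ℝ V] [NormedAddCommGroup W]

/-- The quotient of forward and backward errors, `‖f(D + ε E) - f(D)‖ / (ε ‖E‖)`. -/
def errorRatio (f : V → W) (D E : V) (ε : ℝ) : ℝ≥0∞ :=
  ENNReal.ofReal (‖f (D + ε • E) - f D‖ / (ε * ‖E‖))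

/-- The directional sensitivity `σ_E = lim_{ε → 0⁺} ‖f(D + ε E) - f(D)‖ / (ε ‖E‖) ∈ [0, ∞]`
of the problem `f` at the input `D` with respect to the perturbation `E`. -/
def directionalSensitivity (f : V → W) (D E : V) : ℝ≥0∞ :=
  limUnder (𝓝[>] (0 : ℝ)) (errorRatio f D E)

end

/-- The uniform probability distribution on the unit sphere of a finite-dimensional real normed
space, as a measure on the whole space: the normalised surface measure (the normalisation makes
the choice of the Haar measure irrelevant). For `V = MatPoly 𝕜 n d` this is the uniform
distribution on `S^{βN-1}`, where `N = n² (d + 1)`. -/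
def uniformSphere (V : Type*) [NormedAddCommGroup V] [NormedSpace ℝ V] [FiniteDimensional ℝ V]
    [MeasurableSpace V] [BorelSpace V] : Measure V :=
  haveI : ProperSpace V := FiniteDimensional.proper_real V
  (((Measure.addHaar : Measure V).toSphere Set.univ)⁻¹ •
    (Measure.addHaar : Measure V).toSphere).map Subtype.val

end MatrixPolynomial

end

/-! At a simple eigenvalue the adjugate of `P(λ)` is a nonzero multiple of `v u*`. Jacobi's formula
then gives the first-order motion of the root of `det (P + εE)`: the limit of `(f(P + εE) - λ)/ε` is
`-u*E(λ)v / u*P'(λ)v`. The map `E ↦ u*E(λ)v` is `√(∑ |λ|^{2j})` times the pairing of `E` with a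
complex vector `η` of norm one (`sesqVector`). Hence `σ_E = |⟨η, E⟩| / γ_P` almost surely
(`tendsto_errorRatio`, `sesq_evalAt`), and a tail bound for `|⟨η, E⟩|²` at `s = (γ_P t)² ≤ 1`
remains to be proved.

As a real-linear map, the pairing factors through a plane. The set `s‖x‖² < |⟨η, x⟩|²` is a cone, so
its uniform probability is also its Gaussian probability. Polar coordinates in the plane
(`uniformSphere_lt_normSq`) turn this into the average over `θ` of `(1 - s/c(θ))₊^{k/2}`, where `k`
is the codimension of the plane and `c(θ)` is the value of the quadratic form in direction `θ`.

Over `ℂ` one has `c = 1` and `k = 2(N - 1)`, and `1 - s ≤ e^{-s}` suffices. Over `ℝ` the form only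
has trace one and `k = N - 2`, so the same estimate falls short by a factor `e^{-s/2}`. For `N ≥ 3`
this factor is recovered by averaging `θ` with `θ + π/2`, where the form takes the value `1 - c(θ)`
(`tailFun_add_tailFun_le`). For `N = 2` that argument breaks down. There `u*P(λ)v = 0` makes `P`
itself a nonzero vector in the kernel of the form, so `c(θ) = cos² θ` in a suitable frame. For `N =
1` the bound is trivial. -/

namespace MatrixPolynomial

/-! ### Uniform measure of cones via radial densities -/

section Cone

variable {V : Type*} [NormedAddCommGroup V] [NormedSpace ℝ V] [FiniteDimensional ℝ V]
  [MeasurableSpace V] [BorelSpace V]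

/-- Polar coordinates for the integral of a radial function over a cone. -/
lemma setLIntegral_cone_radial (ν : Measure V) [ν.IsAddHaarMeasure] [Nontrivial V] {A : Set V}
    (hA : MeasurableSet A) (hcone : ∀ r : ℝ, 0 < r → ∀ x, r • x ∈ A ↔ x ∈ A)
    {g : ℝ → ℝ≥0∞} (hg : Measurable g) :
    ∫⁻ x in A, g ‖x‖ ∂ν = ν.toSphere (Subtype.val ⁻¹' A) *
      ∫⁻ r, g r.1 ∂(Measure.volumeIoiPow (Module.finrank ℝ V - 1)) := by
  have hmp := ν.measurePreserving_homeomorphUnitSphereProd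
  have hms : MeasurableSet ({0}ᶜ : Set V) := (measurableSet_singleton _).compl
  calc ∫⁻ x in A, g ‖x‖ ∂ν
      = ∫⁻ x, A.indicator (fun x => g ‖x‖) x ∂ν := (lintegral_indicator hA _).symm
    _ = ∫⁻ x in ({0}ᶜ : Set V), A.indicator (fun x => g ‖x‖) x ∂ν := by
        rw [restrict_compl_singleton]
    _ = ∫⁻ x : ({0}ᶜ : Set V), A.indicator (fun x => g ‖x‖) x ∂(ν.comap Subtype.val) :=
        (lintegral_subtype_comap hms _).symm
    _ = ∫⁻ x : ({0}ᶜ : Set V), (fun p : Metric.sphere (0 : V) 1 × Set.Ioi (0 : ℝ) =>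
          (Subtype.val ⁻¹' A : Set (Metric.sphere (0 : V) 1)).indicator 1 p.1 * g p.2.1)
            (homeomorphUnitSphereProd V x) ∂(ν.comap Subtype.val) := by
        refine lintegral_congr fun x => ?_
        have hx : 0 < ‖(x : V)‖ := norm_pos_iff.2 x.2
        have h := hcone ‖(x : V)‖⁻¹ (inv_pos.2 hx) x
        by_cases hxA : (x : V) ∈ A
        · simp [hxA, h.2 hxA, Set.indicator]
        · have h' : ‖(x : V)‖⁻¹ • (x : V) ∉ A := fun h'' => hxA (h.1 h'')
          simp [hxA, h', Set.indicator]
    _ = _ := by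
        rw [hmp.lintegral_comp (f := fun p : Metric.sphere (0 : V) 1 × Set.Ioi (0 : ℝ) =>
          (Subtype.val ⁻¹' A : Set (Metric.sphere (0 : V) 1)).indicator 1 p.1 * g p.2.1)]
        · rw [lintegral_prod_mul (f := (Subtype.val ⁻¹' A : Set (Metric.sphere (0 : V) 1)).indicator 1)
            (g := fun r : Set.Ioi (0 : ℝ) => g r.1)]
          · rw [lintegral_indicator_one (measurable_subtype_coe hA)]
          · exact (measurable_one.indicator (measurable_subtype_coe hA)).aemeasurable
          · exact (hg.comp measurable_subtype_coe).aemeasurable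
        · exact ((measurable_one.indicator (measurable_subtype_coe hA)).comp measurable_fst).mul
            (hg.comp (measurable_subtype_coe.comp measurable_snd))

lemma uniformSphere_apply {A : Set V} (hA : MeasurableSet A) :
    uniformSphere V A = ((Measure.addHaar : Measure V).toSphere Set.univ)⁻¹ *
      (Measure.addHaar : Measure V).toSphere (Subtype.val ⁻¹' A) := by
  rw [uniformSphere, Measure.map_apply measurable_subtype_coe hA]
  simp

/-- The uniform measure of a cone, computed with a radial density. -/
lemma uniformSphere_mul_lintegral (ν : Measure V) [ν.IsAddHaarMeasure] [Nontrivial V] {A : Set V}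
    (hA : MeasurableSet A) (hcone : ∀ r : ℝ, 0 < r → ∀ x, r • x ∈ A ↔ x ∈ A)
    {g : ℝ → ℝ≥0∞} (hg : Measurable g) :
    uniformSphere V A * ∫⁻ x, g ‖x‖ ∂ν = ∫⁻ x in A, g ‖x‖ ∂ν := by
  have key : uniformSphere V A * ∫⁻ x : V, g ‖x‖ ∂Measure.addHaar
      = ∫⁻ x in A, g ‖x‖ ∂(Measure.addHaar : Measure V) := by
    have h1 := setLIntegral_cone_radial (V := V) Measure.addHaar hA hcone hg
    have h2 := setLIntegral_cone_radial (V := V) Measure.addHaar MeasurableSet.univ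
      (fun r _ x => by simp) hg
    rw [Measure.restrict_univ, Set.preimage_univ] at h2
    rw [h1, h2, uniformSphere_apply hA]
    have h0 : (Measure.addHaar : Measure V).toSphere Set.univ ≠ 0 :=
      (Measure.measure_univ_eq_zero).not.2 (Measure.toSphere_ne_zero _)
    have ht : (Measure.addHaar : Measure V).toSphere Set.univ ≠ ∞ := measure_ne_top _ _
    calc _ = ((Measure.addHaar : Measure V).toSphere Set.univ)⁻¹ *
          (Measure.addHaar : Measure V).toSphere Set.univ *
          ((Measure.addHaar : Measure V).toSphere (Subtype.val ⁻¹' A) *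
      ∫⁻ r, g r.1 ∂(Measure.volumeIoiPow (Module.finrank ℝ V - 1))) := by ring
      _ = _ := by rw [ENNReal.inv_mul_cancel h0 ht, one_mul]
  -- All Haar measures are proportional and the constant appears on both sides, so one choice of `ν`
  -- settles all.
  have hν := Measure.isAddLeftInvariant_eq_smul ν (Measure.addHaar : Measure V)
  rw [hν, Measure.restrict_smul, lintegral_smul_measure, lintegral_smul_measure, ← key]
  simp only [ENNReal.smul_def, smul_eq_mul]
  ring

/-- A proper subspace is a Haar-null cone. In the polar formula with the open unit ball as radial
cutoff the radial factor is positive, so the spherical factor must vanish. -/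
lemma uniformSphere_submodule [Nontrivial V] (K : Submodule ℝ V) (hK : K ≠ ⊤) :
    uniformSphere V {x | x ∈ K} = 0 := by
  have hA : MeasurableSet {x | x ∈ K} := K.closed_of_finiteDimensional.measurableSet
  have h0 : (Measure.addHaar : Measure V) {x | x ∈ K} = 0 := Measure.addHaar_submodule _ K hK
  have h := setLIntegral_cone_radial (V := V) Measure.addHaar hA
    (fun r hr x => K.smul_mem_iff hr.ne') (g := (Set.Iio 1).indicator 1)
    (measurable_one.indicator measurableSet_Iio)
  rw [Measure.restrict_eq_zero.2 h0, lintegral_zero_measure] at h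
  rw [uniformSphere_apply hA]
  have : ∫⁻ r : Set.Ioi (0 : ℝ), (Set.Iio (1 : ℝ)).indicator (1 : ℝ → ℝ≥0∞) r.1
      ∂(Measure.volumeIoiPow (Module.finrank ℝ V - 1)) ≠ 0 := by
    have h1 : ∀ r : Set.Ioi (0 : ℝ), (Set.Iio (1 : ℝ)).indicator (1 : ℝ → ℝ≥0∞) r.1
        = (Set.Iio (⟨1, Set.mem_Ioi.2 one_pos⟩ : Set.Ioi (0 : ℝ))).indicator 1 r := fun r => by
      simp only [Set.indicator, Set.mem_Iio, Pi.one_apply, ← Subtype.coe_lt_coe]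
    simp_rw [h1]
    rw [lintegral_indicator_one measurableSet_Iio, Measure.volumeIoiPow_apply_Iio]
    simp only [ne_eq, ENNReal.ofReal_eq_zero, not_le]
    positivity
  rw [(mul_eq_zero.1 h.symm).resolve_right this, mul_zero]

lemma isProbabilityMeasure_uniformSphere [Nontrivial V] :
    IsProbabilityMeasure (uniformSphere V) := by
  refine ⟨?_⟩
  rw [uniformSphere_apply MeasurableSet.univ, Set.preimage_univ]
  refine ENNReal.inv_mul_cancel ?_ (measure_ne_top _ _)
  exact (Measure.measure_univ_eq_zero).not.2 (Measure.toSphere_ne_zero _)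

lemma uniformSphere_norm_eq_one : ∀ᵐ x ∂(uniformSphere V), ‖x‖ = 1 := by
  rw [uniformSphere, ae_map_iff measurable_subtype_coe.aemeasurable
    (measurableSet_eq_fun measurable_norm measurable_const)]
  exact ae_of_all _ fun x => by simp

end Cone

/-! ### Gaussian integrals -/

section Gauss

lemma lintegral_exp_neg_mul_sq_norm (W : Type*) [NormedAddCommGroup W] [InnerProductSpace ℝ W]
    [FiniteDimensional ℝ W] [MeasurableSpace W] [BorelSpace W] {b : ℝ} (hb : 0 < b) :
    ∫⁻ x : W, ENNReal.ofReal (Real.exp (-b * ‖x‖ ^ 2)) =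
      ENNReal.ofReal ((Real.pi / b) ^ ((Module.finrank ℝ W : ℝ) / 2)) := by
  rw [← GaussianFourier.integral_rexp_neg_mul_sq_norm hb, ofReal_integral_eq_lintegral_ofReal]
  · have h := GaussianFourier.integrable_cexp_neg_mul_sq_norm_add (V := W) (b := (b : ℂ))
      (by simpa using hb) 0 0
    refine (h.norm).congr (ae_of_all _ fun x => ?_)
    simp [Complex.norm_exp, ← Complex.ofReal_pow]
  · exact ae_of_all _ fun x => (Real.exp_pos _).le

lemma lintegral_Ioi_mul_exp_neg_sq {a : ℝ} (ha : 0 ≤ a) :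
    ∫⁻ r in Set.Ioi a, ENNReal.ofReal (r * Real.exp (-r ^ 2)) =
      ENNReal.ofReal (Real.exp (-a ^ 2) / 2) := by
  have hd : ∀ x ∈ Set.Ici a,
      HasDerivAt (fun r : ℝ => -Real.exp (-r ^ 2) / 2) (x * Real.exp (-x ^ 2)) x := by
    intro x _
    have h := (((hasDerivAt_pow 2 x).neg).exp.neg).div_const 2
    refine h.congr_deriv ?_
    simp only [Nat.cast_ofNat, Nat.add_one_sub_one, pow_one, Pi.neg_apply]
    ring
  have hnn : ∀ x ∈ Set.Ioi a, 0 ≤ x * Real.exp (-x ^ 2) := fun x hx =>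
    mul_nonneg (ha.trans (le_of_lt hx)) (Real.exp_pos _).le
  have hl : Tendsto (fun r : ℝ => -Real.exp (-r ^ 2) / 2) atTop (𝓝 0) := by
    have h1 : Tendsto (fun r : ℝ => Real.exp (-r ^ 2)) atTop (𝓝 0) :=
      Real.tendsto_exp_atBot.comp (tendsto_neg_atTop_atBot.comp (tendsto_pow_atTop two_ne_zero))
    simpa using h1.neg.div_const 2
  have hi := integrableOn_Ioi_deriv_of_nonneg' hd hnn hl
  have hv := integral_Ioi_of_hasDerivAt_of_nonneg' hd hnn hl
  rw [← ofReal_integral_eq_lintegral_ofReal hi, hv]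
  · congr 1; ring
  · exact (ae_restrict_iff' measurableSet_Ioi).2 (ae_of_all _ hnn)

end Gauss

/-! ### Orthonormal coordinates: a plane and its complement -/

section Frame

variable {V : Type*} [NormedAddCommGroup V] [InnerProductSpace ℝ V] [FiniteDimensional ℝ V]

open Module in
/-- Cartesian coordinates adapted to an orthonormal pair and its orthogonal complement. -/
lemma exists_frame {e₁ e₂ : V} (h₁ : ‖e₁‖ = 1) (h₂ : ‖e₂‖ = 1) (h₁₂ : inner ℝ e₁ e₂ = 0)
    {W : Submodule ℝ V} (hW₁ : ∀ z ∈ W, inner ℝ e₁ z = 0) (hW₂ : ∀ z ∈ W, inner ℝ e₂ z = 0)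
    (hdim : finrank ℝ W + 2 = finrank ℝ V) :
    ∃ T : ((ℝ × ℝ) × W) ≃L[ℝ] V, (∀ x y z, T ((x, y), z) = x • e₁ + y • e₂ + z) ∧
      ∀ x y z, ‖T ((x, y), z)‖ ^ 2 = x ^ 2 + y ^ 2 + ‖z‖ ^ 2 := by
  let T : ((ℝ × ℝ) × W) →ₗ[ℝ] V :=
    ((LinearMap.toSpanSingleton ℝ V e₁).coprod (LinearMap.toSpanSingleton ℝ V e₂)).coprod W.subtype
  have hT : ∀ x y z, T ((x, y), z) = x • e₁ + y • e₂ + z := fun x y z => by simp [T]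
  have hn : ∀ x y z, ‖T ((x, y), z)‖ ^ 2 = x ^ 2 + y ^ 2 + ‖z‖ ^ 2 := fun x y z => by
    have ha : inner ℝ (x • e₁ + y • e₂) (z : V) = 0 := by
      rw [inner_add_left, inner_smul_left, inner_smul_left, hW₁ _ z.2, hW₂ _ z.2]; simp
    have hb : inner ℝ (x • e₁) (y • e₂) = 0 := by
      rw [inner_smul_left, inner_smul_right, h₁₂]; simp
    have h3 := norm_add_sq_eq_norm_sq_add_norm_sq_of_inner_eq_zero _ _ ha
    have h4 := norm_add_sq_eq_norm_sq_add_norm_sq_of_inner_eq_zero _ _ hb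
    rw [hT, sq, h3, h4, norm_smul, norm_smul, h₁, h₂]
    simp only [mul_one, Real.norm_eq_abs, abs_mul_abs_self, Submodule.coe_norm]
    ring
  have hinj : Function.Injective T := by
    rw [← LinearMap.ker_eq_bot, LinearMap.ker_eq_bot']
    rintro ⟨⟨x, y⟩, z⟩ h
    have := hn x y z
    rw [h, norm_zero] at this
    have hx : x = 0 := by nlinarith [sq_nonneg x, sq_nonneg y, sq_nonneg ‖z‖]
    have hy : y = 0 := by nlinarith [sq_nonneg x, sq_nonneg y, sq_nonneg ‖z‖]
    have hz : ‖z‖ = 0 := by nlinarith [sq_nonneg x, sq_nonneg y, sq_nonneg ‖z‖]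
    rw [hx, hy, norm_eq_zero.1 hz]; rfl
  have hd : finrank ℝ ((ℝ × ℝ) × W) = finrank ℝ V := by
    simp only [finrank_prod, finrank_self]; omega
  refine ⟨(LinearEquiv.ofInjectiveOfFinrankEq T hinj hd).toContinuousLinearEquiv, ?_, ?_⟩
  · exact fun x y z => hT x y z
  · exact fun x y z => hn x y z

end Frame

/-- The probability `ℙ(r² c > s)`, as a function of `s` and `c`, for the squared length `r²` of the projection of
a uniform point of a sphere to a plane, in codimension `k`. -/
noncomputable def tailFun (k : ℕ) (s c : ℝ) : ℝ := if s < c then (1 - s / c) ^ ((k : ℝ) / 2) else 0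

/-! ### Integration over the radius in the plane and over the complement -/

section Radial

variable {W : Type*} [NormedAddCommGroup W] [InnerProductSpace ℝ W] [FiniteDimensional ℝ W]
  [MeasurableSpace W] [BorelSpace W]

/-- For fixed `z` the event is `r > a` with `a² = s‖z‖²/(c - s)`. The `r`-integral has an elementary
primitive, and what is left is a Gaussian in `z` with parameter `1 + s/(c - s) = c/(c - s)`, which
is the source of the power of `1 - s/c`. -/
lemma lintegral_radial {s c : ℝ} (hs : 0 ≤ s) :
    ∫⁻ r in Set.Ioi (0 : ℝ), ∫⁻ z : W, ENNReal.ofReal r *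
      {z : W | s * (r ^ 2 + ‖z‖ ^ 2) < r ^ 2 * c}.indicator
        (fun z => ENNReal.ofReal (Real.exp (-(r ^ 2 + ‖z‖ ^ 2)))) z =
    ENNReal.ofReal (Real.pi ^ ((Module.finrank ℝ W : ℝ) / 2) / 2 *
      tailFun (Module.finrank ℝ W) s c) := by
  by_cases hc : s < c
  swap
  · have : ∀ r : ℝ, {z : W | s * (r ^ 2 + ‖z‖ ^ 2) < r ^ 2 * c} = ∅ := fun r => by
      ext z
      simp only [Set.mem_ofPred_eq, Set.mem_empty_iff_false, iff_false, not_lt]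
      nlinarith [sq_nonneg r, mul_nonneg hs (sq_nonneg ‖z‖), not_lt.1 hc,
        mul_le_mul_of_nonneg_left (not_lt.1 hc) (sq_nonneg r)]
    simp [this, tailFun, hc]
  have hcs : 0 < c - s := sub_pos.2 hc
  have hc0 : 0 < c := hs.trans_lt hc
  rw [lintegral_lintegral_swap]
  swap
  · refine Measurable.aemeasurable ?_
    have : (fun p : ℝ × W => ENNReal.ofReal p.1 *
      {z : W | s * (p.1 ^ 2 + ‖z‖ ^ 2) < p.1 ^ 2 * c}.indicator
        (fun z => ENNReal.ofReal (Real.exp (-(p.1 ^ 2 + ‖z‖ ^ 2)))) p.2) =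
      fun p : ℝ × W => ENNReal.ofReal p.1 *
      {p : ℝ × W | s * (p.1 ^ 2 + ‖p.2‖ ^ 2) < p.1 ^ 2 * c}.indicator
        (fun p => ENNReal.ofReal (Real.exp (-(p.1 ^ 2 + ‖p.2‖ ^ 2)))) p := by
      ext p; simp [Set.indicator]
    change Measurable (fun p : ℝ × W => ENNReal.ofReal p.1 *
      {z : W | s * (p.1 ^ 2 + ‖z‖ ^ 2) < p.1 ^ 2 * c}.indicator
        (fun z => ENNReal.ofReal (Real.exp (-(p.1 ^ 2 + ‖z‖ ^ 2)))) p.2)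
    rw [this]
    refine Measurable.mul (by fun_prop) (Measurable.indicator (by fun_prop) ?_)
    exact measurableSet_lt (by fun_prop) (by fun_prop)
  have hin : ∀ z : W, ∫⁻ r in Set.Ioi (0 : ℝ), ENNReal.ofReal r *
      {z : W | s * (r ^ 2 + ‖z‖ ^ 2) < r ^ 2 * c}.indicator
        (fun z => ENNReal.ofReal (Real.exp (-(r ^ 2 + ‖z‖ ^ 2)))) z =
      ENNReal.ofReal (1 / 2) * ENNReal.ofReal (Real.exp (-(c / (c - s)) * ‖z‖ ^ 2)) := fun z => by
    set a : ℝ := √(s / (c - s)) * ‖z‖ with ha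
    have ha0 : 0 ≤ a := by positivity
    have ha2 : a ^ 2 = s / (c - s) * ‖z‖ ^ 2 := by
      rw [ha, mul_pow, Real.sq_sqrt (div_nonneg hs hcs.le)]
    have hiff : ∀ r ∈ Set.Ioi (0 : ℝ), (s * (r ^ 2 + ‖z‖ ^ 2) < r ^ 2 * c ↔ r ∈ Set.Ioi a) := by
      intro r hr
      rw [Set.mem_Ioi, ← sq_lt_sq₀ ha0 (le_of_lt hr), ha2, div_mul_eq_mul_div, div_lt_iff₀ hcs]
      constructor <;> intro h <;> nlinarith
    have h1 : ∀ r ∈ Set.Ioi (0 : ℝ), ENNReal.ofReal r *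
      {z : W | s * (r ^ 2 + ‖z‖ ^ 2) < r ^ 2 * c}.indicator
        (fun z => ENNReal.ofReal (Real.exp (-(r ^ 2 + ‖z‖ ^ 2)))) z =
        (Set.Ioi a).indicator (fun r => ENNReal.ofReal (Real.exp (-‖z‖ ^ 2)) *
          ENNReal.ofReal (r * Real.exp (-r ^ 2))) r := by
      intro r hr
      have hr0 : (0 : ℝ) < r := hr
      by_cases h : r ∈ Set.Ioi a
      · have h' := (hiff r hr).2 h
        rw [Set.indicator_of_mem (by exact h'), Set.indicator_of_mem h,
          ← ENNReal.ofReal_mul hr0.le, ← ENNReal.ofReal_mul (Real.exp_pos _).le]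
        congr 1
        rw [neg_add, Real.exp_add]; ring
      · have h' := fun h'' => h ((hiff r hr).1 h'')
        rw [Set.indicator_of_notMem (by exact h'), Set.indicator_of_notMem h, mul_zero]
    rw [setLIntegral_congr_fun measurableSet_Ioi h1, lintegral_indicator measurableSet_Ioi,
      Measure.restrict_restrict measurableSet_Ioi,
      Set.inter_eq_left.2 (Set.Ioi_subset_Ioi ha0), lintegral_const_mul _ (by fun_prop),
      lintegral_Ioi_mul_exp_neg_sq ha0, ← ENNReal.ofReal_mul (Real.exp_pos _).le,
      ← ENNReal.ofReal_mul (by norm_num)]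
    congr 1
    rw [ha2, mul_div_assoc', ← Real.exp_add, div_eq_inv_mul, one_div]
    congr 2
    field_simp
    ring
  simp_rw [hin]
  rw [lintegral_const_mul _ (by fun_prop), lintegral_exp_neg_mul_sq_norm W (div_pos hc0 hcs),
    ← ENNReal.ofReal_mul (by norm_num)]
  congr 1
  rw [tailFun, if_pos hc]
  have : Real.pi / (c / (c - s)) = Real.pi * (1 - s / c) := by field_simp
  rw [this, Real.mul_rpow Real.pi_pos.le]
  · ring
  · rw [sub_nonneg, div_le_one hc0]; exact hc.le

lemma lintegral_gauss_prod :
    ∫⁻ p : (ℝ × ℝ) × W, ENNReal.ofReal (Real.exp (-(p.1.1 ^ 2 + p.1.2 ^ 2 + ‖p.2‖ ^ 2))) =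
      ENNReal.ofReal (Real.pi * Real.pi ^ ((Module.finrank ℝ W : ℝ) / 2)) := by
  have h1 : ∫⁻ x : ℝ, ENNReal.ofReal (Real.exp (-x ^ 2)) = ENNReal.ofReal (√Real.pi) := by
    have := lintegral_exp_neg_mul_sq_norm ℝ one_pos
    simpa [Real.sqrt_eq_rpow] using this
  have h3 : ∫⁻ z : W, ENNReal.ofReal (Real.exp (-‖z‖ ^ 2)) =
      ENNReal.ofReal (Real.pi ^ ((Module.finrank ℝ W : ℝ) / 2)) := by
    have := lintegral_exp_neg_mul_sq_norm W one_pos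
    simpa using this
  have h2 : ∫⁻ p : ℝ × ℝ, ENNReal.ofReal (Real.exp (-p.1 ^ 2)) *
      ENNReal.ofReal (Real.exp (-p.2 ^ 2)) = ENNReal.ofReal Real.pi := by
    rw [Measure.volume_eq_prod, lintegral_prod_mul (f := fun x : ℝ => ENNReal.ofReal (Real.exp (-x ^ 2)))
      (g := fun x : ℝ => ENNReal.ofReal (Real.exp (-x ^ 2))) (by fun_prop) (by fun_prop), h1,
      ← ENNReal.ofReal_mul (Real.sqrt_nonneg _), Real.mul_self_sqrt Real.pi_pos.le]
  rw [ENNReal.ofReal_mul Real.pi_pos.le, ← h2, ← h3, ← lintegral_prod_mul (by fun_prop) (by fun_prop),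
    ← Measure.volume_eq_prod]
  refine lintegral_congr fun p => ?_
  rw [← ENNReal.ofReal_mul (Real.exp_pos _).le, ← ENNReal.ofReal_mul (by positivity),
    ← Real.exp_add, ← Real.exp_add]
  congr 2; ring

end Radial

/-! ### Exact distribution as an average over angles -/

section Formula

variable {V : Type*} [NormedAddCommGroup V] [InnerProductSpace ℝ V] [FiniteDimensional ℝ V]
  [MeasurableSpace V] [BorelSpace V]

open Module in
/-- The distribution of `‖L x‖²` for `x` uniform on the sphere, if `L` factors through the
plane spanned by the orthonormal pair `e₁, e₂`. -/
theorem uniformSphere_lt_normSq {e₁ e₂ : V} (h₁ : ‖e₁‖ = 1) (h₂ : ‖e₂‖ = 1)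
    (h₁₂ : inner ℝ e₁ e₂ = 0)
    {W : Submodule ℝ V} (hW₁ : ∀ z ∈ W, inner ℝ e₁ z = 0) (hW₂ : ∀ z ∈ W, inner ℝ e₂ z = 0)
    (hdim : finrank ℝ W + 2 = finrank ℝ V) (L : V →ₗ[ℝ] ℂ) (hL : ∀ z ∈ W, L z = 0)
    {s : ℝ} (hs : 0 ≤ s) :
    uniformSphere V {x | s * ‖x‖ ^ 2 < ‖L x‖ ^ 2} =
      ENNReal.ofReal (1 / (2 * Real.pi)) * ∫⁻ θ in Set.Ioo (-Real.pi) Real.pi,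
        ENNReal.ofReal (tailFun (finrank ℝ W) s (‖Real.cos θ • L e₁ + Real.sin θ • L e₂‖ ^ 2)) := by
  obtain ⟨T, hT, hTn⟩ := exists_frame h₁ h₂ h₁₂ hW₁ hW₂ hdim
  have : Nontrivial V := ⟨⟨e₁, 0, fun h => by simp [h] at h₁⟩⟩
  have hLc : Continuous L := L.continuous_of_finiteDimensional
  set A : Set V := {x | s * ‖x‖ ^ 2 < ‖L x‖ ^ 2} with hAdef
  have hA : MeasurableSet A := measurableSet_lt (by fun_prop) (by fun_prop)
  have hcone : ∀ r : ℝ, 0 < r → ∀ x, r • x ∈ A ↔ x ∈ A := fun r hr x => by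
    have hr2 : 0 < r ^ 2 := by positivity
    simp only [hAdef, Set.mem_ofPred_eq, map_smul, norm_smul, mul_pow, Real.norm_eq_abs, sq_abs]
    rw [mul_left_comm, mul_lt_mul_iff_right₀ hr2]
  have hprod : (volume : Measure ((ℝ × ℝ) × W)).IsAddHaarMeasure :=
    Measure.prod.instIsAddHaarMeasure (volume : Measure (ℝ × ℝ)) (volume : Measure W)
  -- Being a Haar measure is all that is required of the image, so the determinant of `T` need not
  -- be computed.
  have hmap := T.isAddHaarMeasure_map (volume : Measure ((ℝ × ℝ) × W))
  have h := uniformSphere_mul_lintegral ((volume : Measure ((ℝ × ℝ) × W)).map T) hA hcone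
    (g := fun t => ENNReal.ofReal (Real.exp (-t ^ 2))) (by fun_prop)
  rw [lintegral_map (by fun_prop) T.continuous.measurable, ← lintegral_indicator hA,
    lintegral_map ((by fun_prop : Measurable _).indicator hA) T.continuous.measurable] at h
  have htot : ∫⁻ p, ENNReal.ofReal (Real.exp (-‖T p‖ ^ 2)) =
      ENNReal.ofReal (Real.pi * Real.pi ^ ((finrank ℝ W : ℝ) / 2)) := by
    rw [← lintegral_gauss_prod]
    exact lintegral_congr fun p => by rw [hTn p.1.1 p.1.2 p.2]
  set F : ℝ × ℝ → ℝ≥0∞ := fun p => ∫⁻ z : W,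
    A.indicator (fun x => ENNReal.ofReal (Real.exp (-‖x‖ ^ 2))) (T (p, z)) with hF
  have hFm : Measurable fun q : (ℝ × ℝ) × W =>
      A.indicator (fun x => ENNReal.ofReal (Real.exp (-‖x‖ ^ 2))) (T q) :=
    ((by fun_prop : Measurable _).indicator hA).comp T.continuous.measurable
  have hFmeas : Measurable F := hFm.lintegral_prod_right'
  have hpolar : ∫⁻ p, A.indicator (fun x => ENNReal.ofReal (Real.exp (-‖x‖ ^ 2))) (T p) =
      ∫⁻ θ in Set.Ioo (-Real.pi) Real.pi, ∫⁻ r in Set.Ioi (0 : ℝ),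
        ENNReal.ofReal r * F (r * Real.cos θ, r * Real.sin θ) := by
    rw [Measure.volume_eq_prod, lintegral_prod _ hFm.aemeasurable,
      ← lintegral_comp_polarCoord_symm, polarCoord_target, Measure.volume_eq_prod,
      ← Measure.prod_restrict, lintegral_prod_symm]
    · simp [polarCoord_symm_apply, hF]
    · refine Measurable.aemeasurable ?_
      have : Measurable fun p : ℝ × ℝ => polarCoord.symm p := by
        simp only [polarCoord_symm_apply]; fun_prop
      exact Measurable.mul (ENNReal.measurable_ofReal.comp measurable_fst) (hFmeas.comp this)
  have hinner : ∀ θ : ℝ, ∫⁻ r in Set.Ioi (0 : ℝ),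
      ENNReal.ofReal r * F (r * Real.cos θ, r * Real.sin θ) =
      ENNReal.ofReal (Real.pi ^ ((finrank ℝ W : ℝ) / 2) / 2) * ENNReal.ofReal
        (tailFun (finrank ℝ W) s (‖Real.cos θ • L e₁ + Real.sin θ • L e₂‖ ^ 2)) := fun θ => by
    rw [← ENNReal.ofReal_mul (by positivity), ← lintegral_radial hs]
    refine lintegral_congr fun r => ?_
    rw [hF, ← lintegral_const_mul _ (by exact hFm.comp measurable_prodMk_left)]
    refine lintegral_congr fun z => ?_
    have e1 : ‖T ((r * Real.cos θ, r * Real.sin θ), z)‖ ^ 2 = r ^ 2 + ‖z‖ ^ 2 := by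
      rw [hTn]; linear_combination r ^ 2 * Real.sin_sq_add_cos_sq θ
    have e2 : ‖L (T ((r * Real.cos θ, r * Real.sin θ), z))‖ ^ 2 =
        r ^ 2 * ‖Real.cos θ • L e₁ + Real.sin θ • L e₂‖ ^ 2 := by
      rw [hT, map_add, hL z z.2, add_zero, map_add, map_smul, map_smul, mul_smul, mul_smul,
        ← smul_add, norm_smul, mul_pow, Real.norm_eq_abs, sq_abs]
    simp only [Set.indicator, hAdef, Set.mem_ofPred_eq, e1, e2]
  rw [htot, hpolar] at h
  simp_rw [hinner] at h
  have hπ : 0 < Real.pi * Real.pi ^ ((finrank ℝ W : ℝ) / 2) := by positivity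
  rw [lintegral_const_mul' _ _ ENNReal.ofReal_ne_top] at h
  have h0 : ENNReal.ofReal (Real.pi * Real.pi ^ ((finrank ℝ W : ℝ) / 2)) ≠ 0 := by
    simpa using hπ
  rw [← ENNReal.mul_left_inj h0 ENNReal.ofReal_ne_top, h, mul_right_comm,
    ← ENNReal.ofReal_mul (by positivity)]
  congr 2
  field_simp

end Formula

/-! ### Scalar inequalities -/

section Scalar

lemma tailFun_nonneg {s c : ℝ} (hs : 0 ≤ s) (k : ℕ) : 0 ≤ tailFun k s c := by
  rw [tailFun]
  split_ifs with h
  · exact Real.rpow_nonneg (sub_nonneg.2 ((div_le_one (hs.trans_lt h)).2 h.le)) _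
  · exact le_rfl

lemma measurable_tailFun (k : ℕ) (s : ℝ) : Measurable (tailFun k s) := by
  unfold tailFun
  exact Measurable.ite measurableSet_Ioi (by fun_prop) measurable_const

lemma one_sub_div_rpow_le {s c m : ℝ} (hs : 0 ≤ s) (hsc : s < c) (hc : c ≤ 1) (hm : 0 ≤ m) :
    (1 - s / c) ^ m ≤ Real.exp (-(m * s)) := by
  have hc0 : 0 < c := hs.trans_lt hsc
  have h1 : s ≤ s / c := by rw [le_div_iff₀ hc0]; nlinarith
  have h2 : 1 - s / c ≤ Real.exp (-s) := by linarith [Real.add_one_le_exp (-s)]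
  calc (1 - s / c) ^ m ≤ Real.exp (-s) ^ m :=
        Real.rpow_le_rpow (sub_nonneg.2 ((div_le_one hc0).2 hsc.le)) h2 hm
    _ = Real.exp (-(m * s)) := by rw [← Real.exp_mul]; congr 1; ring

lemma tailFun_le {s c : ℝ} (hs : 0 ≤ s) (hc : c ≤ 1) (k : ℕ) :
    tailFun k s c ≤ Real.exp (-((k : ℝ) / 2 * s)) := by
  rw [tailFun]
  split_ifs with h
  · exact one_sub_div_rpow_le hs h hc (by positivity)
  · positivity

/-- With `E = e^{-s}`, each root satisfies `x ≤ (x² + E²)/(2E)`. The squares add up to at most `2 -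
4s`, because `1/c + 1/(1 - c) ≥ 4`, and `1 - 2s ≤ E²`. -/
lemma sqrt_one_sub_div_add_le {s c : ℝ} (hs : 0 ≤ s) (h : s < c) (h' : s < 1 - c) :
    √(1 - s / c) + √(1 - s / (1 - c)) ≤ 2 * Real.exp (-s) := by
  have hc : 0 < c := hs.trans_lt h
  have hc' : 0 < 1 - c := hs.trans_lt h'
  have hx : 0 ≤ 1 - s / c := sub_nonneg.2 ((div_le_one hc).2 h.le)
  have hy : 0 ≤ 1 - s / (1 - c) := sub_nonneg.2 ((div_le_one hc').2 h'.le)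
  set E := Real.exp (-s)
  have hE : 0 < E := Real.exp_pos _
  have hE2 : 1 - 2 * s ≤ E ^ 2 := by
    have := Real.add_one_le_exp (-(2 * s))
    have h2 : E ^ 2 = Real.exp (-(2 * s)) := by
      rw [← Real.exp_nat_mul]; congr 1; push_cast; ring
    rw [h2]; linarith
  have hsum : 4 * s ≤ s / c + s / (1 - c) := by
    rw [div_add_div _ _ hc.ne' hc'.ne', le_div_iff₀ (mul_pos hc hc')]
    nlinarith [mul_nonneg hs (sq_nonneg (2 * c - 1))]
  have hX := Real.sq_sqrt hx
  have hY := Real.sq_sqrt hy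
  nlinarith [sq_nonneg (√(1 - s / c) - E), sq_nonneg (√(1 - s / (1 - c)) - E)]

/-- Averaging over a right angle. -/
lemma tailFun_add_tailFun_le {s c : ℝ} {k : ℕ} (hk : 1 ≤ k) (hs : 0 ≤ s) (hs1 : s ≤ 1)
    (hc : 0 ≤ c) (hc1 : c ≤ 1) :
    tailFun k s c + tailFun k s (1 - c) ≤ 2 * Real.exp (-(((k : ℝ) + 1) / 2 * s)) := by
  have hhalf : 1 / 2 ≤ Real.exp (-(s / 2)) := by linarith [Real.add_one_le_exp (-(s / 2))]
  have hsplit : Real.exp (-(((k : ℝ) + 1) / 2 * s)) =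
      Real.exp (-((k : ℝ) / 2 * s)) * Real.exp (-(s / 2)) := by
    rw [← Real.exp_add]; congr 1; ring
  have hE := Real.exp_pos (-((k : ℝ) / 2 * s))
  have h1 := tailFun_le hs hc1 k
  have h2 := tailFun_le hs (sub_le_self 1 hc) k
  by_cases h : s < c
  -- If one term vanishes, the other is at most `e^{-ks/2}`, and the factor 2 pays for the missing
  -- `e^{-s/2} ≥ 1/2`; this is where `s ≤ 1` enters.
  swap
  · have : tailFun k s c = 0 := by rw [tailFun, if_neg h]
    rw [this, hsplit]; nlinarith
  by_cases h' : s < 1 - c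
  swap
  · have : tailFun k s (1 - c) = 0 := by rw [tailFun, if_neg h']
    rw [this, hsplit]; nlinarith
  have hm : 0 ≤ ((k : ℝ) - 1) / 2 := by
    have : (1 : ℝ) ≤ k := by exact_mod_cast hk
    linarith
  -- Only a square root is kept back from the crude estimate; the exponents `(k-1)/2` and `1` then
  -- add up to `(k+1)/2`.
  have key : ∀ c : ℝ, c ≤ 1 → s < c →
      tailFun k s c ≤ Real.exp (-(((k : ℝ) - 1) / 2 * s)) * √(1 - s / c) := fun c hc1 h => by
    have hpos : 0 < 1 - s / c := sub_pos.2 ((div_lt_one (hs.trans_lt h)).2 h)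
    rw [tailFun, if_pos h, Real.sqrt_eq_rpow,
      show (k : ℝ) / 2 = ((k : ℝ) - 1) / 2 + 1 / 2 by ring, Real.rpow_add hpos]
    exact mul_le_mul_of_nonneg_right (one_sub_div_rpow_le hs h hc1 hm) (Real.rpow_nonneg hpos.le _)
  calc _ ≤ Real.exp (-(((k : ℝ) - 1) / 2 * s)) * (√(1 - s / c) + √(1 - s / (1 - c))) := by
        rw [mul_add]; exact add_le_add (key c hc1 h) (key _ (sub_le_self 1 hc) h')
    _ ≤ Real.exp (-(((k : ℝ) - 1) / 2 * s)) * (2 * Real.exp (-s)) :=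
        mul_le_mul_of_nonneg_left (sqrt_one_sub_div_add_le hs h h') (Real.exp_pos _).le
    _ = _ := by
        rw [mul_left_comm, ← Real.exp_add]; congr 2; ring

/-- Since `|cos θ|` is at most the distance from `θ` to `±π/2`, the set avoids windows of radius
`√s` around both points. The remaining length `2π - 4√s` is at most `2π(1 - s/2)`, by `π ≤ 4` and `s
≤ √s`. -/
lemma volume_lt_cos_sq_le {s : ℝ} (hs : 0 ≤ s) (hs1 : s ≤ 1) :
    volume {θ ∈ Set.Ioo (-Real.pi) Real.pi | s < Real.cos θ ^ 2} ≤
      ENNReal.ofReal (2 * Real.pi * Real.exp (-(s / 2))) := by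
  have hq0 := Real.sqrt_nonneg s
  have hq1 : √s ≤ 1 := Real.sqrt_le_one.2 hs1
  have hπ := Real.pi_gt_three
  have hπ4 := Real.pi_le_four
  have hsub : {θ ∈ Set.Ioo (-Real.pi) Real.pi | s < Real.cos θ ^ 2} ⊆
      Set.Icc (-Real.pi) (-(Real.pi / 2) - √s) ∪ Set.Icc (-(Real.pi / 2) + √s) (Real.pi / 2 - √s) ∪
        Set.Icc (Real.pi / 2 + √s) Real.pi := by
    rintro θ ⟨⟨h1, h2⟩, h3⟩
    have e1 : s < (Real.pi / 2 - θ) ^ 2 := h3.trans_le (by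
      rw [← Real.sin_pi_div_two_sub]; exact sq_le_sq.2 (Real.abs_sin_le_abs ..))
    have e2 : s < (Real.pi / 2 + θ) ^ 2 := h3.trans_le (by
      rw [← Real.cos_neg, ← Real.sin_pi_div_two_sub, sub_neg_eq_add]
      exact sq_le_sq.2 (Real.abs_sin_le_abs ..))
    have a1 := Real.sqrt_lt_sqrt hs e1
    have a2 := Real.sqrt_lt_sqrt hs e2
    rw [Real.sqrt_sq_eq_abs, lt_abs] at a1 a2
    simp only [Set.mem_union, Set.mem_Icc]
    rcases a1 with a1 | a1 <;> rcases a2 with a2 | a2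
    · left; right; constructor <;> linarith
    · left; left; constructor <;> linarith
    · right; constructor <;> linarith
    · linarith
  refine (measure_mono hsub).trans ((measure_union_le _ _).trans
    ((add_le_add_left (measure_union_le _ _) _).trans ?_))
  simp only [Real.volume_Icc]
  rw [← ENNReal.ofReal_add (by linarith) (by linarith),
    ← ENNReal.ofReal_add (by linarith) (by linarith)]
  apply ENNReal.ofReal_le_ofReal
  have : s ≤ √s := by
    calc s = √s * √s := (Real.mul_self_sqrt hs).symm
      _ ≤ √s * 1 := by gcongr
      _ = √s := mul_one _
  nlinarith [Real.add_one_le_exp (-(s / 2))]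

end Scalar

/-! ### Tail bounds for pairs of real functionals -/

section Bounds

variable {V : Type*} [NormedAddCommGroup V] [InnerProductSpace ℝ V]

/-- The real-linear map `x ↦ ⟪a, x⟫ + i ⟪b, x⟫`. -/
noncomputable def innerPair (a b : V) : V →ₗ[ℝ] ℂ :=
  (Complex.ofRealCLM.toLinearMap ∘ₗ (innerSL ℝ a).toLinearMap) +
    Complex.I • (Complex.ofRealCLM.toLinearMap ∘ₗ (innerSL ℝ b).toLinearMap)

lemma innerPair_apply (a b x : V) :
    innerPair a b x = (inner ℝ a x : ℂ) + Complex.I * (inner ℝ b x : ℂ) := by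
  simp [innerPair]

lemma norm_innerPair_sq (a b x : V) : ‖innerPair a b x‖ ^ 2 = inner ℝ a x ^ 2 + inner ℝ b x ^ 2 := by
  rw [innerPair_apply, Complex.sq_norm, Complex.normSq_apply]
  simp
  ring

/-- A quarter turn of the direction replaces the value of a quadratic form on a plane by its trace
minus that value. -/
lemma norm_cos_smul_add_sin_smul_sq (x y : ℂ) (θ : ℝ) :
    ‖Real.cos θ • y + Real.sin θ • -x‖ ^ 2 =
      ‖x‖ ^ 2 + ‖y‖ ^ 2 - ‖Real.cos θ • x + Real.sin θ • y‖ ^ 2 := by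
  simp only [Complex.sq_norm, Complex.normSq_apply]
  simp only [Complex.add_re, Complex.add_im, Complex.real_smul, Complex.mul_re, Complex.mul_im,
    Complex.ofReal_re, Complex.ofReal_im, Complex.neg_re, Complex.neg_im]
  linear_combination (x.re ^ 2 + x.im ^ 2 + y.re ^ 2 + y.im ^ 2) * Real.sin_sq_add_cos_sq θ

open Module in
lemma exists_submodule_le_finrank_eq (M : Submodule ℝ V) {k : ℕ} (hk : k ≤ finrank ℝ M) :
    ∃ W ≤ M, finrank ℝ W = k := by
  obtain ⟨f, hf⟩ := exists_linearIndependent_of_le_finrank hk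
  refine ⟨(Submodule.span ℝ (Set.range f)).map M.subtype, Submodule.map_subtype_le _ _, ?_⟩
  rw [Submodule.finrank_map_subtype_eq, finrank_span_eq_card hf, Fintype.card_fin]

lemma ofReal_inv_two_pi_mul (x : ℝ) :
    ENNReal.ofReal (1 / (2 * Real.pi)) * ENNReal.ofReal (2 * Real.pi * x) = ENNReal.ofReal x := by
  rw [← ENNReal.ofReal_mul (by positivity)]
  congr 1; field_simp

lemma setLIntegral_const_circle (x : ℝ) :
    ∫⁻ _ in Set.Ioo (-Real.pi) Real.pi, ENNReal.ofReal x = ENNReal.ofReal (2 * Real.pi * x) := by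
  rw [setLIntegral_const, Real.volume_Ioo, mul_comm, ← ENNReal.ofReal_mul (by linarith [Real.pi_pos])]
  congr 1; ring

variable [FiniteDimensional ℝ V] [MeasurableSpace V] [BorelSpace V]

open Module in
/-- Tail bound for a form of trace one in dimension at least three. -/
lemma uniformSphere_innerPair_lt {a b : V} (hab : ‖a‖ ^ 2 + ‖b‖ ^ 2 = 1) {k : ℕ} (hk : 1 ≤ k)
    (hV : finrank ℝ V = k + 2) {s : ℝ} (hs : 0 ≤ s) (hs1 : s ≤ 1) :
    uniformSphere V {x | s * ‖x‖ ^ 2 < ‖innerPair a b x‖ ^ 2} ≤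
      ENNReal.ofReal (Real.exp (-(((k : ℝ) + 1) / 2 * s))) := by
  have hrank : k ≤ finrank ℝ (Submodule.span ℝ {a, b})ᗮ := by
    have h1 := Submodule.finrank_add_finrank_orthogonal (Submodule.span ℝ {a, b})
    have h2 : finrank ℝ (Submodule.span ℝ {a, b}) ≤ 2 := by
      classical
      have := finrank_span_finset_le_card (R := ℝ) ({a, b} : Finset V)
      rw [Set.finrank, Finset.coe_pair] at this
      exact this.trans Finset.card_le_two
    omega
  -- The vectors `a` and `b` may be dependent; `W` is cut down to dimension exactly `k` so that its
  -- complement is a plane.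
  obtain ⟨W, hWle, hW⟩ := exists_submodule_le_finrank_eq _ hrank
  have hWa : ∀ z ∈ W, inner ℝ a z = 0 := fun z hz =>
    Submodule.inner_right_of_mem_orthogonal (Submodule.subset_span (by simp)) (hWle hz)
  have hWb : ∀ z ∈ W, inner ℝ b z = 0 := fun z hz =>
    Submodule.inner_right_of_mem_orthogonal (Submodule.subset_span (by simp)) (hWle hz)
  have hWperp : finrank ℝ Wᗮ = 2 := by
    have := Submodule.finrank_add_finrank_orthogonal W; omega
  let e : OrthonormalBasis (Fin 2) ℝ Wᗮ := (stdOrthonormalBasis ℝ Wᗮ).reindex (finCongr hWperp)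
  have he : ∀ i, ‖(e i : V)‖ = 1 := fun i => e.orthonormal.1 i
  have he01 : inner ℝ (e 0 : V) (e 1 : V) = 0 := e.orthonormal.2 (by decide : (0 : Fin 2) ≠ 1)
  have heW : ∀ i, ∀ z ∈ W, inner ℝ (e i : V) z = 0 := fun i z hz =>
    Submodule.inner_left_of_mem_orthogonal hz (e i).2
  have hpars : ∀ c : V, (∀ z ∈ W, inner ℝ c z = 0) →
      inner ℝ c (e 0 : V) ^ 2 + inner ℝ c (e 1 : V) ^ 2 = ‖c‖ ^ 2 := fun c hc => by
    have hcm : c ∈ Wᗮ := (Submodule.mem_orthogonal' W c).2 hc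
    have := e.sum_sq_norm_inner_left ⟨c, hcm⟩
    simpa [Fin.sum_univ_two] using this
  set L := innerPair a b with hLdef
  have hLW : ∀ z ∈ W, L z = 0 := fun z hz => by
    rw [hLdef, innerPair_apply, hWa z hz, hWb z hz]; simp
  have htr : ‖L (e 0)‖ ^ 2 + ‖L (e 1)‖ ^ 2 = 1 := by
    rw [norm_innerPair_sq, norm_innerPair_sq, ← hab, ← hpars a hWa, ← hpars b hWb]; ring
  have f1 := uniformSphere_lt_normSq (he 0) (he 1) he01 (heW 0) (heW 1) (by omega) L hLW hs
  -- The same probability in the frame turned by a right angle; adding the two formulas pairs `c θ`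
  -- with `1 - c θ`.
  have f2 := uniformSphere_lt_normSq (e₂ := -(e 0 : V)) (he 1) (by rw [norm_neg, he 0])
    (by rw [inner_neg_right, real_inner_comm, he01, neg_zero]) (heW 1)
    (fun z hz => by rw [inner_neg_left, heW 0 z hz, neg_zero]) (by omega) L hLW hs
  simp only [map_neg, norm_cos_smul_add_sin_smul_sq, htr, hW] at f1 f2
  set c : ℝ → ℝ := fun θ => ‖Real.cos θ • L (e 0) + Real.sin θ • L (e 1)‖ ^ 2 with hcdef
  have hc0 : ∀ θ, 0 ≤ c θ := fun θ => by positivity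
  have hc1 : ∀ θ, c θ ≤ 1 := fun θ => by
    have := norm_cos_smul_add_sin_smul_sq (L (e 0)) (L (e 1)) θ
    rw [htr] at this
    have h' := sq_nonneg ‖Real.cos θ • L (e 1) + Real.sin θ • -L (e 0)‖
    rw [this] at h'
    exact sub_nonneg.1 h'
  have hcm : Measurable c := by
    rw [hcdef]; fun_prop
  have h2 : 2 * uniformSphere V {x | s * ‖x‖ ^ 2 < ‖L x‖ ^ 2} ≤
      2 * ENNReal.ofReal (Real.exp (-(((k : ℝ) + 1) / 2 * s))) := by
    rw [two_mul]
    nth_rewrite 1 [f1]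
    have hm : Measurable fun θ => ENNReal.ofReal (tailFun k s (c θ)) :=
      ENNReal.measurable_ofReal.comp ((measurable_tailFun k s).comp hcm)
    rw [f2, ← mul_add, ← lintegral_add_left hm]
    calc _ ≤ ENNReal.ofReal (1 / (2 * Real.pi)) * ∫⁻ _ in Set.Ioo (-Real.pi) Real.pi,
          ENNReal.ofReal (2 * Real.exp (-(((k : ℝ) + 1) / 2 * s))) := by
          gcongr with θ
          rw [← ENNReal.ofReal_add (tailFun_nonneg hs k) (tailFun_nonneg hs k)]
          exact ENNReal.ofReal_le_ofReal (tailFun_add_tailFun_le hk hs hs1 (hc0 θ) (hc1 θ))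
      _ = _ := by
          rw [setLIntegral_const_circle, ofReal_inv_two_pi_mul, ENNReal.ofReal_mul zero_le_two]
          simp
  exact (ENNReal.mul_le_mul_iff_right two_ne_zero ENNReal.ofNat_ne_top).1 h2

open Module in
/-- Tail bound for a degenerate form of trace one on a plane. -/
lemma uniformSphere_innerPair_lt_of_finrank_eq_two {a b : V} (hab : ‖a‖ ^ 2 + ‖b‖ ^ 2 = 1)
    (hV : finrank ℝ V = 2) {p : V} (hp : p ≠ 0) (hp0 : innerPair a b p = 0)
    {s : ℝ} (hs : 0 ≤ s) (hs1 : s ≤ 1) :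
    uniformSphere V {x | s * ‖x‖ ^ 2 < ‖innerPair a b x‖ ^ 2} ≤
      ENNReal.ofReal (Real.exp (-(s / 2))) := by
  have hq : ‖(‖p‖⁻¹ • p)‖ = 1 := by
    rw [norm_smul, norm_inv, norm_norm, inv_mul_cancel₀ (norm_ne_zero_iff.2 hp)]
  have hrestr : Orthonormal ℝ (({1} : Set (Fin 2)).domRestrict fun _ => ‖p‖⁻¹ • p) :=
    ⟨fun _ => hq, fun i j hij => (hij (Subsingleton.elim i j)).elim⟩
  obtain ⟨e, he⟩ := hrestr.exists_orthonormalBasis_extension_of_card_eq (by simp [hV])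
  have he1 : innerPair a b (e 1) = 0 := by
    rw [he 1 rfl, map_smul, hp0, smul_zero]
  have he0 : ‖innerPair a b (e 0)‖ ^ 2 = 1 := by
    have h1 : ‖innerPair a b (e 0)‖ ^ 2 + ‖innerPair a b (e 1)‖ ^ 2 = 1 := by
      have ha := e.sum_sq_norm_inner_left a
      have hb := e.sum_sq_norm_inner_left b
      simp only [Fin.sum_univ_two, Real.norm_eq_abs, sq_abs] at ha hb
      rw [norm_innerPair_sq, norm_innerPair_sq, ← hab, ← ha, ← hb]; ring
    simpa [he1] using h1
  have f := uniformSphere_lt_normSq (W := ⊥) (e.orthonormal.1 0) (e.orthonormal.1 1)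
    (e.orthonormal.2 (by decide : (0 : Fin 2) ≠ 1)) (by simp) (by simp) (by simp [hV])
    (innerPair a b) (by simp) hs
  rw [f]
  refine le_trans ?_ (ofReal_inv_two_pi_mul _).le
  gcongr
  refine le_trans (le_of_eq ?_) (volume_lt_cos_sq_le hs hs1)
  have hSm : MeasurableSet {θ : ℝ | s < Real.cos θ ^ 2} :=
    measurableSet_lt (by fun_prop) (by fun_prop)
  -- In codimension zero `tailFun` has exponent 0, so it is the indicator of `s < c`; here `c = cos²
  -- θ`, as `e 1` spans the kernel and the trace is one.
  have : ∀ θ : ℝ, ENNReal.ofReal (tailFun (finrank ℝ (⊥ : Submodule ℝ V)) s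
      (‖Real.cos θ • innerPair a b (e 0) + Real.sin θ • innerPair a b (e 1)‖ ^ 2)) =
      {θ : ℝ | s < Real.cos θ ^ 2}.indicator 1 θ := fun θ => by
    rw [he1, smul_zero, add_zero, norm_smul, mul_pow, he0, Real.norm_eq_abs, sq_abs, mul_one]
    simp [tailFun, Set.indicator, apply_ite ENNReal.ofReal]
  simp_rw [this]
  rw [lintegral_indicator_one hSm, Measure.restrict_apply hSm, Set.inter_comm]
  rfl

open Module in
/-- Tail bound for the squared length of the projection to a plane. -/
lemma uniformSphere_innerPair_lt_of_orthonormal {a b : V} (ha : ‖a‖ = 1) (hb : ‖b‖ = 1)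
    (hab : inner ℝ a b = 0) {k : ℕ} (hV : finrank ℝ V = k + 2) {s : ℝ} (hs : 0 ≤ s) :
    uniformSphere V {x | s * ‖x‖ ^ 2 < ‖innerPair a b x‖ ^ 2} ≤
      ENNReal.ofReal (Real.exp (-((k : ℝ) / 2 * s))) := by
  have hli : LinearIndependent ℝ ![a, b] := by
    refine Orthonormal.linearIndependent ⟨?_, ?_⟩
    · intro i; fin_cases i <;> simp [ha, hb]
    · intro i j hij
      fin_cases i <;> fin_cases j <;> simp_all [real_inner_comm]
  have hspan : finrank ℝ (Submodule.span ℝ (Set.range ![a, b])) = 2 := by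
    rw [finrank_span_eq_card hli, Fintype.card_fin]
  set W := (Submodule.span ℝ (Set.range ![a, b]))ᗮ with hWdef
  have hW : finrank ℝ W = k := by
    have := Submodule.finrank_add_finrank_orthogonal (Submodule.span ℝ (Set.range ![a, b]))
    rw [← hWdef] at this
    omega
  have hWa : ∀ z ∈ W, inner ℝ a z = 0 := fun z hz =>
    Submodule.inner_right_of_mem_orthogonal (Submodule.subset_span (by simp)) hz
  have hWb : ∀ z ∈ W, inner ℝ b z = 0 := fun z hz =>
    Submodule.inner_right_of_mem_orthogonal (Submodule.subset_span (by simp)) hz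
  have f := uniformSphere_lt_normSq ha hb hab hWa hWb (by omega)
    (innerPair a b) (fun z hz => by rw [innerPair_apply, hWa z hz, hWb z hz]; simp) hs
  rw [f, hW]
  refine le_trans ?_ (ofReal_inv_two_pi_mul _).le
  rw [← setLIntegral_const_circle]
  gcongr with θ
  -- The map is isometric on the plane, so `c` is constantly 1.
  refine tailFun_le hs (le_of_eq ?_) k
  have hba : inner ℝ b a = 0 := by rw [real_inner_comm, hab]
  rw [innerPair_apply, innerPair_apply, hab, hba, real_inner_self_eq_norm_sq,
    real_inner_self_eq_norm_sq, ha, hb, Complex.sq_norm, Complex.normSq_apply]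
  have hθ := Real.sin_sq_add_cos_sq θ
  generalize Real.cos θ = x at *
  generalize Real.sin θ = y at *
  simp
  linear_combination hθ

/-- Passage from a strict to a weak inequality in a tail bound. -/
lemma uniformSphere_le_of_lt [Nontrivial V] (L : V → ℂ) {κ s : ℝ} (hs : 0 < s)
    (h : ∀ s', 0 ≤ s' → s' < s → uniformSphere V {x | s' * ‖x‖ ^ 2 < ‖L x‖ ^ 2} ≤
      ENNReal.ofReal (Real.exp (-(κ * s')))) :
    uniformSphere V {x | s ≤ ‖L x‖ ^ 2} ≤ ENNReal.ofReal (Real.exp (-(κ * s))) := by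
  have hlim : Tendsto (fun s' : ℝ => ENNReal.ofReal (Real.exp (-(κ * s')))) (𝓝[<] s)
      (𝓝 (ENNReal.ofReal (Real.exp (-(κ * s))))) :=
    ((ENNReal.continuous_ofReal.comp (by fun_prop :
      Continuous fun s' : ℝ => Real.exp (-(κ * s')))).tendsto s).mono_left nhdsWithin_le_nhds
  -- The level `s'` increases to `s`, so no statement about the measure of the boundary is needed.
  refine ge_of_tendsto hlim ?_
  filter_upwards [Ioo_mem_nhdsLT hs] with s' hs'
  refine le_trans (measure_mono_ae ?_) (h s' hs'.1.le hs'.2)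
  filter_upwards [uniformSphere_norm_eq_one (V := V)] with x hx hxs
  change s' * ‖x‖ ^ 2 < ‖L x‖ ^ 2
  rw [hx, one_pow, mul_one]
  exact hs'.2.trans_le hxs

end Bounds

/-! ### Pairing with a complex vector, for real and complex scalars -/

section Scalars

variable {𝕜 : Type*} [RCLike 𝕜]

/-- The adjoint of `toComplex 𝕜` over `ℝ`. -/
noncomputable def ofComplex (𝕜 : Type*) [RCLike 𝕜] (w : ℂ) : 𝕜 := (w.re : 𝕜) + (w.im : 𝕜) * RCLike.I

lemma toComplex_re (x : 𝕜) : (toComplex 𝕜 x).re = RCLike.re x := by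
  simp [toComplex, RCLike.map_apply]

lemma toComplex_im (x : 𝕜) : (toComplex 𝕜 x).im = RCLike.im x := by
  simp [toComplex, RCLike.map_apply]

lemma inner_ofComplex (w : ℂ) (x : 𝕜) :
    inner ℝ (ofComplex 𝕜 w) x = (toComplex 𝕜 x * star w).re := by
  rw [real_inner_eq_re_inner 𝕜, RCLike.inner_apply]
  rcases RCLike.I_eq_zero_or_im_I_eq_one (K := 𝕜) with h | h
  · have h0 := RCLike.im_eq_zero h x
    simp [ofComplex, h, Complex.mul_re, toComplex_re, toComplex_im, h0]
  · simp [ofComplex, h, Complex.mul_re, toComplex_re, toComplex_im]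

lemma norm_ofComplex_sq_real (h : (RCLike.I : 𝕜) = 0) (w : ℂ) :
    ‖ofComplex 𝕜 w‖ ^ 2 = w.re ^ 2 := by
  simp [ofComplex, h]

lemma norm_ofComplex_sq_complex (h : RCLike.im (RCLike.I : 𝕜) = 1) (w : ℂ) :
    ‖ofComplex 𝕜 w‖ ^ 2 = ‖w‖ ^ 2 := by
  rw [← RCLike.normSq_eq_def', RCLike.normSq_apply, Complex.sq_norm, Complex.normSq_apply]
  simp [ofComplex, h]

lemma beta_eq_one (h : (RCLike.I : 𝕜) = 0) : beta 𝕜 = 1 := by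
  rw [beta, (RCLike.realLinearIsometryEquiv h).toLinearEquiv.finrank_eq, Module.finrank_self]

lemma beta_eq_two (h : RCLike.im (RCLike.I : 𝕜) = 1) : beta 𝕜 = 2 := by
  rw [beta, (RCLike.complexLinearIsometryEquiv h).toLinearEquiv.finrank_eq,
    Complex.finrank_real_complex]

variable {ι : Type*} [Fintype ι]

lemma finrank_euclideanSpace_real : Module.finrank ℝ (EuclideanSpace 𝕜 ι) = Fintype.card ι * beta 𝕜 := by
  rw [(WithLp.linearEquiv 2 ℝ (ι → 𝕜)).finrank_eq, Module.finrank_pi_fintype]; simp [beta]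

/-- The bilinear pairing of a vector over `𝕜` with a complex vector. -/
noncomputable def pairing (ω : EuclideanSpace ℂ ι) (x : EuclideanSpace 𝕜 ι) : ℂ :=
  ∑ k, toComplex 𝕜 (x k) * ω k

/-- Over `ℝ`, `a` and `b` are the real and imaginary parts of `ω`. Over `ℂ`, `a` is the conjugate of
`ω` and `b` is `i` times `a`, so that together they span a complex line. -/
lemma exists_innerPair_eq_pairing (ω : EuclideanSpace ℂ ι) :
    ∃ a b : EuclideanSpace 𝕜 ι, (∀ x, innerPair a b x = pairing ω x) ∧
      ((RCLike.I : 𝕜) = 0 → ‖a‖ ^ 2 + ‖b‖ ^ 2 = ‖ω‖ ^ 2) ∧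
      (RCLike.im (RCLike.I : 𝕜) = 1 → ‖a‖ = ‖ω‖ ∧ ‖b‖ = ‖ω‖ ∧ inner ℝ a b = 0) := by
  refine ⟨WithLp.toLp 2 fun k => ofComplex 𝕜 (star (ω k)),
    WithLp.toLp 2 fun k => ofComplex 𝕜 (star (-Complex.I * ω k)), fun x => ?_, fun h => ?_, fun h => ?_⟩
  · rw [innerPair_apply, PiLp.inner_apply, PiLp.inner_apply, pairing]
    simp only [inner_ofComplex, star_star]
    apply Complex.ext
    · simp [Complex.mul_re]
    · simp only [Complex.mul_re]
      simp [Complex.mul_im, add_comm]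
  · simp only [EuclideanSpace.norm_sq_eq, norm_ofComplex_sq_real h, ← Finset.sum_add_distrib]
    refine Finset.sum_congr rfl fun k _ => ?_
    rw [Complex.sq_norm, Complex.normSq_apply]
    simp [Complex.mul_re]; ring
  · refine ⟨?_, ?_, ?_⟩
    · rw [← sq_eq_sq₀ (norm_nonneg _) (norm_nonneg _), EuclideanSpace.norm_sq_eq,
        EuclideanSpace.norm_sq_eq]
      simp [norm_ofComplex_sq_complex h]
    · rw [← sq_eq_sq₀ (norm_nonneg _) (norm_nonneg _), EuclideanSpace.norm_sq_eq,
        EuclideanSpace.norm_sq_eq]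
      simp [norm_ofComplex_sq_complex h]
    · rw [PiLp.inner_apply]
      refine Finset.sum_eq_zero fun k _ => ?_
      simp only [inner_ofComplex]
      simp [Complex.mul_re, toComplex_re, toComplex_im, ofComplex, h]
      ring

lemma continuous_pairing (ω : EuclideanSpace ℂ ι) :
    Continuous (pairing ω : EuclideanSpace 𝕜 ι → ℂ) := by
  obtain ⟨a, b, h, -⟩ := exists_innerPair_eq_pairing (𝕜 := 𝕜) ω
  exact (innerPair a b).continuous_of_finiteDimensional.congr h

lemma uniformSphere_pairing_ne_zero [Nonempty ι] {ω : EuclideanSpace ℂ ι} (hω : ω ≠ 0) :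
    ∀ᵐ x ∂(uniformSphere (EuclideanSpace 𝕜 ι)), pairing ω x ≠ 0 := by
  classical
  obtain ⟨a, b, h, -⟩ := exists_innerPair_eq_pairing (𝕜 := 𝕜) ω
  have hK : LinearMap.ker (innerPair a b) ≠ ⊤ := fun hK => by
    obtain ⟨k, hk⟩ : ∃ k, ω k ≠ 0 := by
      by_contra! h'
      exact hω (by ext k; exact h' k)
    have h1 : EuclideanSpace.single k (1 : 𝕜) ∈ LinearMap.ker (innerPair a b) := hK ▸ trivial
    rw [LinearMap.mem_ker, h, pairing, Finset.sum_eq_single k] at h1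
    · simp at h1; exact hk h1
    · intro j _ hj; simp [hj]
    · simp
  refine measure_mono_null (fun x hx => ?_) (uniformSphere_submodule _ hK)
  change x ∈ LinearMap.ker _
  rw [LinearMap.mem_ker, h]
  simpa using hx

/-- The tail bound for the modulus of a pairing with a unit vector. -/
theorem uniformSphere_pairing_le {ω : EuclideanSpace ℂ ι} (hω : ‖ω‖ = 1)
    {p : EuclideanSpace 𝕜 ι} (hp : p ≠ 0) (hp0 : pairing ω p = 0)
    {s : ℝ} (hs : 0 < s) (hs1 : s ≤ 1) :
    uniformSphere (EuclideanSpace 𝕜 ι) {x | s ≤ ‖pairing ω x‖ ^ 2} ≤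
      ENNReal.ofReal (Real.exp (-((beta 𝕜 : ℝ) * ((Fintype.card ι : ℝ) - 1) / 2 * s))) := by
  obtain ⟨a, b, h, hre, him⟩ := exists_innerPair_eq_pairing (𝕜 := 𝕜) ω
  have : Nontrivial (EuclideanSpace 𝕜 ι) := ⟨⟨p, 0, hp⟩⟩
  have hpos : 1 ≤ Fintype.card ι := by
    by_contra! h0
    have : IsEmpty ι := Fintype.card_eq_zero_iff.1 (by omega)
    exact hp (Subsingleton.elim _ _)
  refine uniformSphere_le_of_lt _ hs fun s' hs' hlt => ?_
  simp only [← h]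
  rcases RCLike.I_eq_zero_or_im_I_eq_one (K := 𝕜) with hI | hI
  · have hdim := finrank_euclideanSpace_real (𝕜 := 𝕜) (ι := ι)
    have hab := hre hI
    rw [hω, one_pow] at hab
    rw [beta_eq_one hI, mul_one] at hdim
    rw [beta_eq_one hI]
    -- For one coordinate the exponent is zero. For two, the kernel vector `p` is indispensable: the
    -- form with `c = 1/2` throughout has tail 1 for `s < 1/2`.
    obtain hc | hc | hc : Fintype.card ι = 1 ∨ Fintype.card ι = 2 ∨ 3 ≤ Fintype.card ι := by omega
    · have := isProbabilityMeasure_uniformSphere (V := EuclideanSpace 𝕜 ι)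
      rw [hc]
      simpa using prob_le_one
    · rw [hc]
      refine (uniformSphere_innerPair_lt_of_finrank_eq_two hab (hdim.trans hc) hp
        ((h p).trans hp0) hs' (hlt.le.trans hs1)).trans (le_of_eq ?_)
      congr 2; push_cast; ring
    · obtain ⟨k, hk⟩ : ∃ k, Fintype.card ι = k + 2 := ⟨Fintype.card ι - 2, by omega⟩
      refine (uniformSphere_innerPair_lt hab (by omega : 1 ≤ k) (hdim.trans hk) hs'
        (hlt.le.trans hs1)).trans (le_of_eq ?_)
      rw [hk]
      congr 2; push_cast; ring
  · have hdim := finrank_euclideanSpace_real (𝕜 := 𝕜) (ι := ι)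
    obtain ⟨ha, hb, hab⟩ := him hI
    rw [beta_eq_two hI] at hdim
    rw [beta_eq_two hI]
    obtain ⟨k, hk⟩ : ∃ k, Fintype.card ι = k + 1 := ⟨Fintype.card ι - 1, by omega⟩
    -- The real dimension is `2k + 2`, so the plane has codimension `2k` and the exponent is `k = N
    -- - 1`.
    refine (uniformSphere_innerPair_lt_of_orthonormal (ha.trans hω) (hb.trans hω) hab
      (k := 2 * k) (by rw [hdim, hk]; ring) hs').trans (le_of_eq ?_)
    rw [hk]
    congr 2; push_cast; ring

end Scalars

/-! ### Adjugates and matrices of corank one -/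

section MatrixLemmas

variable {ι : Type*} [Fintype ι] [DecidableEq ι]

/-- Jacobi's formula for matrices of polynomials. -/
lemma derivative_det {R : Type*} [CommRing R] (M : Matrix ι ι R[X]) :
    derivative M.det = (M.adjugate * M.map derivative).trace := by
  have h1 : derivative M.det = ∑ j, (M.updateCol j fun i => derivative (M i j)).det := by
    simp only [det_apply, derivative_sum]
    rw [Finset.sum_comm]
    refine Finset.sum_congr rfl fun σ _ => ?_
    rw [Units.smul_def, derivative_smul, derivative_prod_finset, ← Finset.smul_sum]
    congr 1
    refine Finset.sum_congr rfl fun j _ => ?_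
    rw [← Finset.mul_prod_erase Finset.univ _ (Finset.mem_univ j), mul_comm]
    congr 1
    · simp
    · refine Finset.prod_congr rfl fun k hk => ?_
      rw [updateCol_ne (Finset.ne_of_mem_erase hk)]
  rw [h1, trace]
  refine Finset.sum_congr rfl fun j _ => ?_
  -- By Cramer's rule, replacing column `j` by its derivative gives the `j`-th diagonal entry of the
  -- product.
  rw [← cramer_apply, cramer_eq_adjugate_mulVec, diag_apply, mul_apply]
  rfl

/-- If the adjugate is nonzero, the kernel is at most one-dimensional. -/
lemma exists_smul_eq_of_mulVec_eq_zero {K : Type*} [Field K] {A : Matrix ι ι K}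
    (hA : A.adjugate ≠ 0) {v w : ι → K} (hv : v ≠ 0) (hAv : A *ᵥ v = 0) (hAw : A *ᵥ w = 0) :
    ∃ t : K, w = t • v := by
  obtain ⟨i, j, hij⟩ : ∃ i j, A.adjugate i j ≠ 0 := by
    by_contra! h
    exact hA (by ext i j; exact h i j)
  rw [adjugate_apply] at hij
  -- The nonzero entry is the determinant of `A` with row `j` replaced by the `i`-th unit vector;
  -- that matrix kills every kernel vector whose `i`-th coordinate is 0.
  have key : ∀ y : ι → K, A *ᵥ y = 0 → y i = 0 → y = 0 := fun y hy hyi => by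
    refine eq_zero_of_mulVec_eq_zero hij ?_
    ext k
    by_cases hk : k = j
    · subst hk
      simp [mulVec, updateRow_self, hyi]
    · have := congrFun hy k
      simpa [mulVec, updateRow_ne hk] using this
  have hvi : v i ≠ 0 := fun h => hv (key v hAv h)
  refine ⟨w i / v i, sub_eq_zero.1 (key _ ?_ ?_)⟩
  · rw [mulVec_sub, mulVec_smul, hAv, hAw, smul_zero, sub_zero]
  · simp [hvi]

/-- The adjugate of a matrix of corank one, in terms of its left and right null vectors. -/
lemma exists_adjugate_eq {A : Matrix ι ι ℂ} (hA : A.adjugate ≠ 0) {u v : ι → ℂ} (hu : u ≠ 0)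
    (hv : v ≠ 0) (hAv : A *ᵥ v = 0) (hAu : Aᴴ *ᵥ u = 0) :
    ∃ c : ℂ, c ≠ 0 ∧ ∀ B : Matrix ι ι ℂ, (A.adjugate * B).trace = c * (star u ⬝ᵥ (B *ᵥ v)) := by
  have hdet : A.det = 0 := by
    by_contra h
    exact hv (eq_zero_of_mulVec_eq_zero h hAv)
  -- Columns of the adjugate lie in the kernel, so it is an outer product of `v` with some `r`; its
  -- rows are left null vectors, which makes `r` a multiple of `star u`.
  have hcol : ∀ j, ∃ t : ℂ, (fun i => A.adjugate i j) = t • v := fun j => by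
    refine exists_smul_eq_of_mulVec_eq_zero hA hv hAv ?_
    ext i
    have := congrFun (congrFun (mul_adjugate A) i) j
    rw [hdet, zero_smul] at this
    exact this
  choose r hr using hcol
  obtain ⟨i₀, hi₀⟩ : ∃ i, v i ≠ 0 := by
    by_contra! h
    exact hv (funext h)
  have hadj : ∀ i j, A.adjugate i j = r j * v i := fun i j => congrFun (hr j) i
  have hr0 : Aᴴ *ᵥ star r = 0 := by
    rw [← star_vecMul]
    have : r ᵥ* A = 0 := by
      ext k
      have := congrFun (congrFun (adjugate_mul A) i₀) k
      rw [hdet, zero_smul, mul_apply] at this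
      have h2 : v i₀ * (r ᵥ* A) k = 0 := by
        rw [← Matrix.zero_apply i₀ k (α := ℂ), ← this, vecMul, dotProduct, Finset.mul_sum]
        exact Finset.sum_congr rfl fun j _ => by rw [hadj]; ring
      exact (mul_eq_zero.1 h2).resolve_left hi₀
    rw [this, star_zero]
  have hA' : Aᴴ.adjugate ≠ 0 := fun h => hA (by
    rw [← conjTranspose_eq_zero, adjugate_conjTranspose]; exact h)
  obtain ⟨t, ht⟩ := exists_smul_eq_of_mulVec_eq_zero hA' hu hAu hr0
  have hrt : ∀ j, r j = star t * star (u j) := fun j => by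
    have := congrArg star (congrFun ht j)
    simpa [mul_comm] using this
  refine ⟨star t, fun h0 => hA ?_, fun B => ?_⟩
  · ext i j
    rw [hadj, hrt, h0]; simp
  · rw [trace, dotProduct, Finset.mul_sum]
    simp only [diag_apply, mul_apply, hadj, hrt, mulVec, dotProduct, Pi.star_apply, Finset.mul_sum]
    rw [Finset.sum_comm]
    exact Finset.sum_congr rfl fun i _ => Finset.sum_congr rfl fun j _ => by ring

lemma rank_lt_of_det_eq_zero {K : Type*} [Field K] {A : Matrix ι ι K} (h : A.det = 0) :
    A.rank < Fintype.card ι := by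
  refine lt_of_le_of_ne A.rank_le_card_width fun hr => ?_
  obtain ⟨v, hv, hAv⟩ := exists_mulVec_eq_zero_iff.2 h
  have htop : LinearMap.range A.mulVecLin = ⊤ := by
    apply Submodule.eq_top_of_finrank_eq
    rw [Module.finrank_fintype_fun_eq_card]; exact hr
  have hinj := LinearMap.injective_iff_surjective.2 (LinearMap.range_eq_top.1 htop)
  exact hv (hinj (by simpa using hAv))

end MatrixLemmas

/-! ### First-order perturbation of a simple root -/

section Perturbation

lemma continuous_evalEval {R : Type*} [CommRing R] [TopologicalSpace R] [IsTopologicalRing R]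
    (p : R[X][X]) : Continuous fun q : R × R => p.evalEval q.1 q.2 := by
  induction p using Polynomial.induction_on' with
  | add p q hp hq => simp only [evalEval_add]; exact hp.add hq
  | monomial k a =>
    have : ∀ q : R × R, (monomial k a).evalEval q.1 q.2 = a.eval q.1 * q.2 ^ k := fun q => by
      rw [evalEval, eval_monomial, eval_mul, eval_pow, eval_C]
    simp_rw [this]
    exact (a.continuous.comp continuous_fst).mul (continuous_snd.pow k)

variable {ι : Type*} [Fintype ι] [DecidableEq ι]

/-- First-order expansion of a perturbed determinant. -/
lemma exists_det_add_smul_expansion (A B : Matrix ι ι ℂ[X]) :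
    ∃ h : ℂ × ℂ → ℂ, Continuous h ∧ (∀ x, h (x, 0) = (A.adjugate * B).trace.eval x) ∧
      ∀ x y : ℂ, (A + C y • B).det.eval x = A.det.eval x + y * h (x, y) := by
  -- The outer variable is the perturbation parameter. Dividing `G` minus its constant term by that
  -- variable gives `h`, whose value at 0 is the linear coefficient, computed by Jacobi's formula.
  set G : ℂ[X][X] := (A.map C + (X : ℂ[X][X]) • B.map C).det with hG
  have heval : ∀ y : ℂ[X], G.eval y = (A + y • B).det := fun y => by
    rw [hG, ← coe_evalRingHom, RingHom.map_det]
    congr 1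
    ext1 i j
    simp
    ring
  have hder : G.coeff 1 = (A.adjugate * B).trace := by
    have h1 : G.coeff 1 = (derivative G).eval 0 := by
      rw [← coeff_zero_eq_eval_zero, coeff_derivative]; simp
    have h2 : (A.map C + (X : ℂ[X][X]) • B.map C).map derivative = B.map C := by
      ext1 i j; simp
    rw [h1, hG, derivative_det, h2, ← coe_evalRingHom, AddMonoidHom.map_trace, Matrix.map_mul,
      ← RingHom.mapMatrix_apply, RingHom.map_adjugate]
    congr 3
    · ext1 i j; simp
    · ext1 i j; simp
  refine ⟨fun q => G.divX.evalEval q.1 q.2, continuous_evalEval _, fun x => ?_, fun x y => ?_⟩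
  · change eval x (eval (C 0) G.divX) = _
    rw [C_0, ← coeff_zero_eq_eval_zero, coeff_divX, zero_add, hder]
  · have h1 := congrArg (fun p => eval x (eval (C y) p)) (divX_mul_X_add G)
    simp only [eval_add, eval_mul, eval_X, eval_C] at h1
    rw [heval, coeff_zero_eq_eval_zero, heval, zero_smul, add_zero] at h1
    change _ = _ + y * eval x (eval (C y) G.divX)
    rw [← h1]; ring

/-- The derivative of a simple root of a perturbed determinant. -/
lemma tendsto_root_sub_div {A B : Matrix ι ι ℂ[X]} {z : ℂ} (hz : A.det.eval z = 0)
    (hz' : A.det.derivative.eval z ≠ 0) {m : ℝ → ℂ} (hm : Tendsto m (𝓝[>] 0) (𝓝 z))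
    (hroot : ∀ᶠ ε : ℝ in 𝓝[>] 0, (A + C (ε : ℂ) • B).det.eval (m ε) = 0) :
    Tendsto (fun ε : ℝ => (m ε - z) / ε) (𝓝[>] 0)
      (𝓝 (-(A.adjugate * B).trace.eval z / A.det.derivative.eval z)) := by
  obtain ⟨h, hcont, h0, hexp⟩ := exists_det_add_smul_expansion A B
  -- With `det A = (X - z) g`, the root equation reads `(m - z) g(m) + ε h(m, ε) = 0`; it is solved
  -- for the quotient and the limit is taken by continuity.
  obtain ⟨g, hg⟩ := dvd_iff_isRoot.2 hz
  have hgz : A.det.derivative.eval z = g.eval z := by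
    rw [hg, derivative_mul]; simp
  have hε : Tendsto (fun ε : ℝ => (ε : ℂ)) (𝓝[>] 0) (𝓝 0) := by
    have := (Complex.continuous_ofReal.tendsto 0).mono_left (nhdsWithin_le_nhds (s := Set.Ioi 0))
    simpa using this
  have hgm : Tendsto (fun ε => g.eval (m ε)) (𝓝[>] 0) (𝓝 (g.eval z)) :=
    (g.continuous.tendsto z).comp hm
  have hhm : Tendsto (fun ε : ℝ => h (m ε, (ε : ℂ))) (𝓝[>] 0) (𝓝 (h (z, 0))) :=
    (hcont.tendsto (z, 0)).comp (hm.prodMk_nhds hε)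
  rw [hgz, ← h0]
  rw [hgz] at hz'
  refine (hhm.neg.div hgm hz').congr' ?_
  filter_upwards [hroot, hgm.eventually_ne hz', self_mem_nhdsWithin] with ε hr hne hpos
  have hε0 : (ε : ℂ) ≠ 0 := Complex.ofReal_ne_zero.2 (ne_of_gt hpos)
  rw [hexp, hg, eval_mul] at hr
  simp only [eval_sub, eval_X, eval_C] at hr
  change -h (m ε, (ε : ℂ)) / g.eval (m ε) = (m ε - z) / ε
  rw [div_eq_div_iff hne hε0]
  linear_combination -hr

/-- A root close to a point where the value is small compared with the derivative. -/
lemma exists_root_norm_sub_le {p : ℂ[X]} {z : ℂ} (hp : p.derivative.eval z ≠ 0) :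
    ∃ r, p.eval r = 0 ∧ ‖r - z‖ ≤ p.natDegree * (‖p.eval z‖ / ‖p.derivative.eval z‖) := by
  by_cases h0 : p.eval z = 0
  · exact ⟨z, h0, by simp [h0]⟩
  have hp0 : p ≠ 0 := fun h => h0 (by simp [h])
  by_contra! hcon
  set δ := (p.natDegree : ℝ) * (‖p.eval z‖ / ‖p.derivative.eval z‖) with hδ
  -- The logarithmic derivative is `p'/p = ∑ 1/(z - r)`. If all roots were farther away than `δ`,
  -- the sum would be smaller than `deg p / δ`, which equals `|p'/p|`.
  have h1 := (IsAlgClosed.splits p).eval_derivative_div_eval_of_ne_zero h0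
  have hcard : p.roots.card = p.natDegree := (IsAlgClosed.splits p).natDegree_eq_card_roots.symm
  have hn : p.roots ≠ 0 := fun h => by
    rw [h] at h1
    simp only [Multiset.map_zero, Multiset.sum_zero, div_eq_zero_iff] at h1
    exact h1.elim hp h0
  have hn0 : 0 < p.natDegree := hcard ▸ Multiset.card_pos.2 hn
  have hd : 0 < ‖p.derivative.eval z‖ := norm_pos_iff.2 hp
  have hv : 0 < ‖p.eval z‖ := norm_pos_iff.2 h0
  have hδ0 : 0 < δ := by positivity
  have h2 : ‖p.derivative.eval z / p.eval z‖ < p.roots.card • δ⁻¹ := by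
    rw [h1]
    calc _ ≤ (p.roots.map fun r => ‖1 / (z - r)‖).sum := by
          refine (norm_multiset_sum_le _).trans_eq ?_
          rw [Multiset.map_map]; rfl
      _ < (p.roots.map fun _ => δ⁻¹).sum := by
          refine Multiset.sum_lt_sum_of_nonempty hn fun r hr => ?_
          rw [norm_div, norm_one, one_div, norm_sub_rev]
          exact inv_strictAnti₀ hδ0 (hcon r (isRoot_of_mem_roots hr))
      _ = _ := by simp
  rw [hcard, norm_div, nsmul_eq_mul, hδ, mul_inv, ← mul_assoc,
    mul_inv_cancel₀ (by exact_mod_cast hn0.ne'), one_mul, inv_div] at h2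
  exact lt_irrefl _ h2

end Perturbation

/-! ### Matrix polynomials as complex polynomial matrices; the limit of the error ratio -/

section Complexification

variable {𝕜 : Type*} [RCLike 𝕜] {n d : ℕ}

/-- A matrix polynomial over `𝕜`, viewed as a matrix of complex polynomials. -/
noncomputable def complexMatrix (A : MatPoly 𝕜 n d) : Matrix (Fin n) (Fin n) ℂ[X] :=
  (toMatrix A).map (mapRingHom (toComplex 𝕜))

lemma evalAt_eq (A : MatPoly 𝕜 n d) (x : ℂ) :
    evalAt A x = (evalRingHom x).mapMatrix (complexMatrix A) := by
  ext i j
  simp [evalAt, complexMatrix, eval₂_eq_eval_map]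

lemma derivAt_eq (A : MatPoly 𝕜 n d) (x : ℂ) :
    derivAt A x = (evalRingHom x).mapMatrix ((complexMatrix A).map derivative) := by
  ext i j
  simp [derivAt, complexMatrix, eval₂_eq_eval_map, derivative_map]

lemma det_complexMatrix (A : MatPoly 𝕜 n d) :
    (complexMatrix A).det = (toMatrix A).det.map (toComplex 𝕜) := by
  rw [← coe_mapRingHom, RingHom.map_det]; rfl

lemma toMatrix_add_smul (A B : MatPoly 𝕜 n d) (ε : ℝ) :
    toMatrix (A + ε • B) = toMatrix A + C (ε : 𝕜) • toMatrix B := by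
  ext1 i j
  simp only [toMatrix, of_apply, Matrix.add_apply, Matrix.smul_apply, smul_eq_mul, Finset.mul_sum,
    C_mul_monomial, ← Finset.sum_add_distrib, ← map_add]
  simp [RCLike.real_smul_eq_coe_mul]

lemma complexMatrix_add_smul (A B : MatPoly 𝕜 n d) (ε : ℝ) :
    complexMatrix (A + ε • B) = complexMatrix A + C (ε : ℂ) • complexMatrix B := by
  have h : toComplex 𝕜 (ε : 𝕜) = (ε : ℂ) := by
    apply Complex.ext <;> simp [toComplex_re, toComplex_im]
  rw [complexMatrix, toMatrix_add_smul]
  ext1 i j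
  simp [complexMatrix, h]

lemma eval_det_complexMatrix (A : MatPoly 𝕜 n d) (x : ℂ) :
    (complexMatrix A).det.eval x = (evalAt A x).det := by
  rw [evalAt_eq, ← RingHom.map_det]; rfl

lemma eval_trace_adjugate_mul (A B : MatPoly 𝕜 n d) (x : ℂ) :
    ((complexMatrix A).adjugate * complexMatrix B).trace.eval x =
      ((evalAt A x).adjugate * evalAt B x).trace := by
  rw [← coe_evalRingHom, AddMonoidHom.map_trace, Matrix.map_mul, ← RingHom.mapMatrix_apply,
    RingHom.map_adjugate, evalAt_eq, evalAt_eq]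
  rfl

lemma eval_derivative_det (A : MatPoly 𝕜 n d) (x : ℂ) :
    (complexMatrix A).det.derivative.eval x = ((evalAt A x).adjugate * derivAt A x).trace := by
  rw [derivative_det, ← coe_evalRingHom, AddMonoidHom.map_trace, Matrix.map_mul,
    ← RingHom.mapMatrix_apply, RingHom.map_adjugate, evalAt_eq, derivAt_eq]
  rfl

/-- The degree of `det (P + εE)` may vary with `ε`; this bound makes the root estimate uniform. -/
lemma natDegree_det_complexMatrix_le (A : MatPoly 𝕜 n d) :
    (complexMatrix A).det.natDegree ≤ n * d := by
  have hent : ∀ i j, (complexMatrix A i j).natDegree ≤ d := fun i j => by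
    refine (natDegree_map_le (f := toComplex 𝕜) (p := toMatrix A i j)).trans ?_
    rw [toMatrix, of_apply]
    exact natDegree_sum_le_of_forall_le Finset.univ
      (fun k : Fin (d + 1) => monomial (k : ℕ) (A (k, i, j)))
      fun k _ => (natDegree_monomial_le _).trans (Nat.lt_succ_iff.1 k.2)
  rw [det_apply]
  refine natDegree_sum_le_of_forall_le _ _ fun σ _ => ?_
  refine (natDegree_smul_le _ _).trans ((natDegree_prod_le _ _).trans ?_)
  refine (Finset.sum_le_card_nsmul _ _ d fun i _ => hent _ _).trans ?_
  simp

lemma isRegular_iff (A : MatPoly 𝕜 n d) : IsRegular A ↔ (complexMatrix A).det ≠ 0 := by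
  rw [det_complexMatrix, IsRegular, Ne, Ne, Polynomial.map_eq_zero]

lemma IsEigenvalue.eval_det {A : MatPoly 𝕜 n d} {x : ℂ} (h : IsEigenvalue A x) :
    (complexMatrix A).det.eval x = 0 := by
  rw [eval_det_complexMatrix]
  by_contra h0
  have h1 := rank_of_det_ne_zero h0
  have h2 : polyRank A ≤ _ := Matrix.rank_le_card_width _
  exact (lt_of_lt_of_le h h2).ne h1

lemma IsRegular.isEigenvalue_iff {A : MatPoly 𝕜 n d} (hA : IsRegular A) (x : ℂ) :
    IsEigenvalue A x ↔ (complexMatrix A).det.eval x = 0 := by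
  refine ⟨IsEigenvalue.eval_det, fun h => ?_⟩
  rw [eval_det_complexMatrix] at h
  have hr : polyRank A = Fintype.card (Fin n) := by
    refine rank_of_det_ne_zero ?_
    rw [← RingHom.mapMatrix_apply, ← RingHom.map_det]
    exact (map_ne_zero_iff _ (IsFractionRing.injective 𝕜[X] (RatFunc 𝕜))).2 hA
  rw [IsEigenvalue, hr]
  exact rank_lt_of_det_eq_zero h

lemma IsSimpleEigenvalue.eval_derivative_ne_zero {P : MatPoly 𝕜 n d} (hP : IsRegular P) {z : ℂ}
    (hz : IsSimpleEigenvalue P z) : (complexMatrix P).det.derivative.eval z ≠ 0 := by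
  intro h
  have h0 := (isRegular_iff P).1 hP
  have h1 := (one_lt_rootMultiplicity_iff_isRoot h0).2 ⟨hz.1.eval_det, h⟩
  rw [det_complexMatrix, hz.2] at h1
  exact lt_irrefl _ h1

lemma sesq_smul_smul (s t : ℂ) (u v : EuclideanSpace ℂ (Fin n)) (M : Matrix (Fin n) (Fin n) ℂ) :
    sesq (s • u) M (t • v) = star s * t * sesq u M v := by
  simp [sesq, mulVec_smul, mul_assoc, mul_left_comm]

variable {P : MatPoly 𝕜 n d} {z : ℂ} {u v : EuclideanSpace ℂ (Fin n)}

lemma IsLeftEigenvector.ofLp_ne_zero (hu : IsLeftEigenvector P z u) : u.ofLp ≠ 0 := fun h =>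
  hu.1 (by ext i; exact congrFun h i)

lemma IsRightEigenvector.ofLp_ne_zero (hv : IsRightEigenvector P z v) : v.ofLp ≠ 0 := fun h =>
  hv.1 (by ext i; exact congrFun h i)

/-- By Jacobi's formula a zero adjugate would make the root of the determinant multiple. -/
lemma adjugate_evalAt_ne_zero (hP : IsRegular P) (hz : IsSimpleEigenvalue P z) :
    (evalAt P z).adjugate ≠ 0 := fun h =>
  hz.eval_derivative_ne_zero hP (by rw [eval_derivative_det, h]; simp)

lemma exists_trace_adjugate_eq (hP : IsRegular P) (hz : IsSimpleEigenvalue P z)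
    (hu : IsLeftEigenvector P z u) (hv : IsRightEigenvector P z v) :
    ∃ c : ℂ, c ≠ 0 ∧ ∀ B, ((evalAt P z).adjugate * B).trace = c * sesq u B v :=
  exists_adjugate_eq (adjugate_evalAt_ne_zero hP hz) hu.ofLp_ne_zero hv.ofLp_ne_zero hv.2 hu.2

lemma sesq_derivAt_ne_zero (hP : IsRegular P) (hz : IsSimpleEigenvalue P z)
    (hu : IsLeftEigenvector P z u) (hv : IsRightEigenvector P z v) :
    sesq u (derivAt P z) v ≠ 0 := fun h => by
  obtain ⟨c, -, hc⟩ := exists_trace_adjugate_eq hP hz hu hv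
  exact hz.eval_derivative_ne_zero hP (by rw [eval_derivative_det, hc, h, mul_zero])

lemma sum_norm_pow_pos (z : ℂ) (d : ℕ) : 0 < ∑ j ∈ Finset.range (d + 1), ‖z‖ ^ (2 * j) := by
  rw [Finset.sum_range_succ']
  have : 0 ≤ ∑ j ∈ Finset.range d, ‖z‖ ^ (2 * (j + 1)) := Finset.sum_nonneg fun j _ => by positivity
  simp only [mul_zero, pow_zero]; linarith

lemma gammaP_pos (hP : IsRegular P) (hz : IsSimpleEigenvalue P z)
    (hu : IsLeftEigenvector P z u) (hv : IsRightEigenvector P z v) : 0 < gammaP P z u v :=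
  div_pos (norm_pos_iff.2 (sesq_derivAt_ne_zero hP hz hu hv))
    (Real.sqrt_pos.2 (sum_norm_pow_pos z d))

/-- Both null spaces of `P(z)` are lines, so all eigenvectors are nonzero multiples of `u` and `v`.
-/
lemma isNondegenerateDirection_of_sesq_ne_zero (hP : IsRegular P) (hz : IsSimpleEigenvalue P z)
    (hu : IsLeftEigenvector P z u) (hv : IsRightEigenvector P z v) {E : MatPoly 𝕜 n d}
    (hE : sesq u (evalAt E z) v ≠ 0) : IsNondegenerateDirection P z E := by
  intro u' v' hu' hv'
  have hadj := adjugate_evalAt_ne_zero hP hz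
  obtain ⟨t, ht⟩ := exists_smul_eq_of_mulVec_eq_zero hadj hv.ofLp_ne_zero hv.2 hv'.2
  have hadj' : (evalAt P z)ᴴ.adjugate ≠ 0 := fun h => hadj (by
    rw [← conjTranspose_eq_zero, adjugate_conjTranspose]; exact h)
  obtain ⟨s, hs⟩ := exists_smul_eq_of_mulVec_eq_zero hadj' hu.ofLp_ne_zero hu.2 hu'.2
  have hv'' : v' = t • v := by ext i; exact congrFun ht i
  have hu'' : u' = s • u := by ext i; exact congrFun hs i
  have ht0 : t ≠ 0 := fun h => hv'.1 (by rw [hv'', h, zero_smul])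
  have hs0 : s ≠ 0 := fun h => hu'.1 (by rw [hu'', h, zero_smul])
  rw [hu'', hv'', sesq_smul_smul]
  exact mul_ne_zero (mul_ne_zero (star_ne_zero.2 hs0) ht0) hE

/-- The traces in the numerator and the denominator of the root's derivative are the same constant
times `u*E(z)v` and `u*P'(z)v`, and the constant cancels. -/
lemma tendsto_errorRatio (hP : IsRegular P) (hz : IsSimpleEigenvalue P z)
    (hu : IsLeftEigenvector P z u) (hv : IsRightEigenvector P z v) {f : MatPoly 𝕜 n d → ℂ}
    (hf : IsEigenvalueMap P z f) {E : MatPoly 𝕜 n d} (hE : sesq u (evalAt E z) v ≠ 0) :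
    Tendsto (errorRatio f P E) (𝓝[>] 0) (𝓝 (ENNReal.ofReal
      (‖sesq u (evalAt E z) v‖ / ‖sesq u (derivAt P z) v‖ / ‖E‖))) := by
  have hnd := isNondegenerateDirection_of_sesq_ne_zero hP hz hu hv hE
  have hlim := tendsto_root_sub_div (A := complexMatrix P) (B := complexMatrix E)
    hz.1.eval_det (hz.eval_derivative_ne_zero hP) (hf.tendsto E hnd) (by
      filter_upwards [hf.isEigenvalue E hnd] with ε hε
      rw [← complexMatrix_add_smul]
      exact hε.eval_det)
  obtain ⟨c, hc0, hc⟩ := exists_trace_adjugate_eq hP hz hu hv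
  rw [eval_trace_adjugate_mul, eval_derivative_det, hc, hc, ← mul_neg, mul_div_mul_left _ _ hc0]
    at hlim
  have h2 := ENNReal.tendsto_ofReal (hlim.norm.div_const ‖E‖)
  rw [norm_div, norm_neg] at h2
  refine h2.congr' ?_
  filter_upwards [self_mem_nhdsWithin] with ε hε
  have hε0 : (0 : ℝ) < ε := hε
  rw [errorRatio, hf.map_self, norm_div, Complex.norm_real, Real.norm_of_nonneg hε0.le, div_div]

end Complexification

/-! ### Existence of an input-output map -/

section Existence

variable {𝕜 : Type*} [RCLike 𝕜] {n d : ℕ}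

lemma evalAt_add_smul (A B : MatPoly 𝕜 n d) (ε : ℝ) (x : ℂ) :
    evalAt (A + ε • B) x = evalAt A x + (ε : ℂ) • evalAt B x := by
  rw [evalAt_eq, evalAt_eq, evalAt_eq, complexMatrix_add_smul]
  ext i j; simp

lemma derivAt_add_smul (A B : MatPoly 𝕜 n d) (ε : ℝ) (x : ℂ) :
    derivAt (A + ε • B) x = derivAt A x + (ε : ℂ) • derivAt B x := by
  rw [derivAt_eq, derivAt_eq, derivAt_eq, complexMatrix_add_smul]
  ext i j; simp

/-- The eigenvalues of a regular matrix polynomial include one that is closest to a given point. -/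
lemma IsRegular.exists_nearest_eigenvalue {A : MatPoly 𝕜 n d} (hA : IsRegular A) (z : ℂ)
    (h : ∃ r, IsEigenvalue A r) :
    ∃ r, IsEigenvalue A r ∧ ∀ r', IsEigenvalue A r' → ‖r - z‖ ≤ ‖r' - z‖ := by
  have hfin : {r | IsEigenvalue A r}.Finite := by
    refine ((complexMatrix A).det.roots.toFinset.finite_toSet).subset fun r hr => ?_
    have hr' : IsEigenvalue A r := hr
    simpa [(isRegular_iff A).1 hA] using hr'.eval_det
  exact Set.exists_min_image _ (fun r => ‖r - z‖) hfin h

/-- An eigenvalue closest to `z`, where there is one. -/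
noncomputable def nearestEigenvalue (z : ℂ) (A : MatPoly 𝕜 n d) : ℂ :=
  open Classical in
  if h : ∃ r, IsEigenvalue A r ∧ ∀ r', IsEigenvalue A r' → ‖r - z‖ ≤ ‖r' - z‖ then h.choose else z

lemma nearestEigenvalue_spec {A : MatPoly 𝕜 n d} (hA : IsRegular A) (z : ℂ)
    (h : ∃ r, IsEigenvalue A r) : IsEigenvalue A (nearestEigenvalue z A) ∧
      ∀ r', IsEigenvalue A r' → ‖nearestEigenvalue z A - z‖ ≤ ‖r' - z‖ := by
  have h' := hA.exists_nearest_eigenvalue z h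
  rw [nearestEigenvalue, dif_pos h']
  exact h'.choose_spec

/-- Along every direction the determinant at `z` tends to 0 while its derivative there stays away
from 0. The perturbation therefore remains regular and has a root within a distance tending to 0,
and the nearest eigenvalue is at least as close. -/
lemma isEigenvalueMap_nearestEigenvalue {P : MatPoly 𝕜 n d} (hP : IsRegular P) {z : ℂ}
    (hz : IsSimpleEigenvalue P z) : IsEigenvalueMap P z (nearestEigenvalue z) := by
  have key : ∀ E : MatPoly 𝕜 n d, ∃ δ : ℝ → ℝ, Tendsto δ (𝓝[>] 0) (𝓝 0) ∧ ∀ᶠ ε : ℝ in 𝓝[>] 0,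
      IsRegular (P + ε • E) ∧ ∃ r, IsEigenvalue (P + ε • E) r ∧ ‖r - z‖ ≤ δ ε := fun E => by
    have hval : Continuous fun ε : ℝ => (complexMatrix (P + ε • E)).det.eval z := by
      simp_rw [eval_det_complexMatrix, evalAt_add_smul]
      exact Continuous.matrix_det (by fun_prop)
    have hder : Continuous fun ε : ℝ => (complexMatrix (P + ε • E)).det.derivative.eval z := by
      simp_rw [eval_derivative_det, evalAt_add_smul, derivAt_add_smul]
      exact Continuous.matrix_trace (Continuous.matrix_mul
        (Continuous.matrix_adjugate (by fun_prop)) (by fun_prop))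
    have hval0 : Tendsto (fun ε : ℝ => (complexMatrix (P + ε • E)).det.eval z) (𝓝[>] 0) (𝓝 0) := by
      have := (hval.tendsto 0).mono_left (nhdsWithin_le_nhds (s := Set.Ioi 0))
      simpa [hz.1.eval_det] using this
    have hder0 : Tendsto (fun ε : ℝ => (complexMatrix (P + ε • E)).det.derivative.eval z) (𝓝[>] 0)
        (𝓝 ((complexMatrix P).det.derivative.eval z)) := by
      have := (hder.tendsto 0).mono_left (nhdsWithin_le_nhds (s := Set.Ioi 0))
      simpa using this
    have hne := hz.eval_derivative_ne_zero hP
    refine ⟨fun ε => ((n * d : ℕ) : ℝ) * (‖(complexMatrix (P + ε • E)).det.eval z‖ /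
      ‖(complexMatrix (P + ε • E)).det.derivative.eval z‖), ?_, ?_⟩
    · have := (hval0.norm.div hder0.norm (norm_ne_zero_iff.2 hne)).const_mul ((n * d : ℕ) : ℝ)
      simpa using this
    · filter_upwards [hder0.eventually_ne hne] with ε hε
      have hreg : IsRegular (P + ε • E) := (isRegular_iff _).2 fun h => hε (by rw [h]; simp)
      obtain ⟨r, hr, hle⟩ := exists_root_norm_sub_le hε
      refine ⟨hreg, r, (hreg.isEigenvalue_iff r).2 hr, hle.trans ?_⟩
      gcongr
      exact natDegree_det_complexMatrix_le _
  refine ⟨?_, fun E _ => ?_, fun E _ => ?_⟩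
  · have := (nearestEigenvalue_spec hP z ⟨z, hz.1⟩).2 z hz.1
    rw [sub_self, norm_zero] at this
    exact sub_eq_zero.1 (norm_le_zero_iff.1 this)
  · obtain ⟨δ, -, h⟩ := key E
    filter_upwards [h] with ε hε
    exact (nearestEigenvalue_spec hε.1 z (hε.2.imp fun r hr => hr.1)).1
  · obtain ⟨δ, hδ, h⟩ := key E
    rw [tendsto_iff_norm_sub_tendsto_zero]
    refine squeeze_zero' (Eventually.of_forall fun _ => norm_nonneg _) ?_ hδ
    filter_upwards [h] with ε hε
    obtain ⟨hreg, r, hr, hle⟩ := hε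
    exact ((nearestEigenvalue_spec hreg z ⟨r, hr⟩).2 r hr).trans hle

end Existence

/-! ### The functional `A ↦ u*A(z)v` as a pairing with a unit vector -/

section Functional

variable {𝕜 : Type*} [RCLike 𝕜] {n d : ℕ}

/-- The coefficients of the linear functional `A ↦ uᴴ A(z) v`, normalised for unit vectors. -/
noncomputable def sesqVector (d : ℕ) (z : ℂ) (u v : EuclideanSpace ℂ (Fin n)) :
    EuclideanSpace ℂ (Fin (d + 1) × Fin n × Fin n) :=
  WithLp.toLp 2 fun p => star (u p.2.1) * z ^ (p.1 : ℕ) * v p.2.2 /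
    (√(∑ j ∈ Finset.range (d + 1), ‖z‖ ^ (2 * j)) : ℂ)

lemma sesq_evalAt (A : MatPoly 𝕜 n d) (z : ℂ) (u v : EuclideanSpace ℂ (Fin n)) :
    sesq u (evalAt A z) v =
      (√(∑ j ∈ Finset.range (d + 1), ‖z‖ ^ (2 * j)) : ℂ) * pairing (sesqVector d z u v) A := by
  have h0 : (√(∑ j ∈ Finset.range (d + 1), ‖z‖ ^ (2 * j)) : ℂ) ≠ 0 :=
    Complex.ofReal_ne_zero.2 (Real.sqrt_pos.2 (sum_norm_pow_pos z d)).ne'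
  have h1 : ∀ i j, evalAt A z i j = ∑ k : Fin (d + 1), toComplex 𝕜 (A (k, i, j)) * z ^ (k : ℕ) :=
    fun i j => by simp [evalAt, toMatrix, eval₂_finsetSum, eval₂_monomial]
  have h2 : (√(∑ j ∈ Finset.range (d + 1), ‖z‖ ^ (2 * j)) : ℂ) * pairing (sesqVector d z u v) A =
      ∑ p : Fin (d + 1) × Fin n × Fin n,
        toComplex 𝕜 (A p) * (star (u p.2.1) * z ^ (p.1 : ℕ) * v p.2.2) := by
    rw [pairing, Finset.mul_sum]
    refine Finset.sum_congr rfl fun p _ => ?_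
    rw [sesqVector, mul_left_comm, mul_div_cancel₀ _ h0]
  rw [h2, Fintype.sum_prod_type]
  simp only [Fintype.sum_prod_type]
  rw [Finset.sum_comm]
  rw [sesq, dotProduct]
  refine Finset.sum_congr rfl fun i _ => ?_
  rw [Finset.sum_comm, mulVec, dotProduct, Finset.mul_sum]
  refine Finset.sum_congr rfl fun j _ => ?_
  rw [h1, Finset.sum_mul, Finset.mul_sum]
  refine Finset.sum_congr rfl fun k _ => ?_
  rw [Pi.star_apply]; ring

/-- The sum of squares factors into the powers of `|z|`, `‖u‖²` and `‖v‖²`; the normalisation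
cancels the first factor. -/
lemma norm_sesqVector (d : ℕ) (z : ℂ) {u v : EuclideanSpace ℂ (Fin n)} (hu : ‖u‖ = 1)
    (hv : ‖v‖ = 1) : ‖sesqVector d z u v‖ = 1 := by
  have hS := sum_norm_pow_pos z d
  rw [← sq_eq_sq₀ (norm_nonneg _) zero_le_one, EuclideanSpace.norm_sq_eq]
  have h : ∀ p : Fin (d + 1) × Fin n × Fin n, ‖sesqVector d z u v p‖ ^ 2 =
      ‖z‖ ^ (2 * (p.1 : ℕ)) * (‖u p.2.1‖ ^ 2 * ‖v p.2.2‖ ^ 2) /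
        ∑ j ∈ Finset.range (d + 1), ‖z‖ ^ (2 * j) := fun p => by
    rw [sesqVector, norm_div, norm_mul, norm_mul, norm_star, norm_pow, Complex.norm_real,
      Real.norm_of_nonneg (Real.sqrt_nonneg _), div_pow, Real.sq_sqrt hS.le]
    ring
  have hu2 := EuclideanSpace.norm_sq_eq u
  have hv2 := EuclideanSpace.norm_sq_eq v
  rw [hu, one_pow] at hu2
  rw [hv, one_pow] at hv2
  simp_rw [h]
  rw [← Finset.sum_div, Fintype.sum_prod_type]
  simp only [Fintype.sum_prod_type, ← Finset.mul_sum, ← hv2, mul_one, ← hu2]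
  rw [Fin.sum_univ_eq_sum_range (fun k => ‖z‖ ^ (2 * k)), div_self hS.ne', one_pow]

end Functional

end MatrixPolynomial

/-! ### The main theorem -/

open MatrixPolynomial in
theorem mainTheorem7 {𝕜 : Type*} [RCLike 𝕜] {n d : ℕ}
    (P : MatrixPolynomial.MatPoly 𝕜 n d) (hP : MatrixPolynomial.IsRegular P)
    (z : ℂ) (hz : MatrixPolynomial.IsSimpleEigenvalue P z)
    (u v : EuclideanSpace ℂ (Fin n))
    (hu : MatrixPolynomial.IsLeftEigenvector P z u) (hu1 : ‖u‖ = 1)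
    (hv : MatrixPolynomial.IsRightEigenvector P z v) (hv1 : ‖v‖ = 1)
    {Ω : Type*} [MeasurableSpace Ω] (μ : Measure Ω) [IsProbabilityMeasure μ]
    (E : Ω → MatrixPolynomial.MatPoly 𝕜 n d)
    (hE : HasLaw E (MatrixPolynomial.uniformSphere (MatrixPolynomial.MatPoly 𝕜 n d)) μ) :
    0 < MatrixPolynomial.gammaP P z u v ∧
    (∃ f, MatrixPolynomial.IsEigenvalueMap P z f) ∧
    ∀ f, MatrixPolynomial.IsEigenvalueMap P z f →
      (∀ᵐ ω ∂μ, Tendsto (MatrixPolynomial.errorRatio f P (E ω)) (𝓝[>] 0)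
        (𝓝 (MatrixPolynomial.directionalSensitivity f P (E ω)))) ∧
      ∀ t : ℝ, 0 ≤ t → t ≤ (MatrixPolynomial.gammaP P z u v)⁻¹ →
        μ.real {ω | ENNReal.ofReal t ≤ MatrixPolynomial.directionalSensitivity f P (E ω)} ≤
          Real.exp (-((MatrixPolynomial.beta 𝕜 : ℝ) * (((n : ℝ) ^ 2 * ((d : ℝ) + 1)) - 1) *
            MatrixPolynomial.gammaP P z u v ^ 2 * t ^ 2 / 2)) := by
  have hγ := gammaP_pos hP hz hu hv
  refine ⟨hγ, ⟨_, isEigenvalueMap_nearestEigenvalue hP hz⟩, fun f hf => ?_⟩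
  set η := sesqVector d z u v
  have hη1 : ‖η‖ = 1 := norm_sesqVector d z hu1 hv1
  have hη0 : η ≠ 0 := fun h => by simp [h] at hη1
  set γ := gammaP P z u v with hγdef
  have hSpos := Real.sqrt_pos.2 (sum_norm_pow_pos z d)
  have : Nonempty (Fin n) := by
    by_contra h
    rw [not_nonempty_iff] at h
    exact hu.1 (Subsingleton.elim _ _)
  have hlaw : ∀ᵐ x ∂(uniformSphere (MatPoly 𝕜 n d)),
      Tendsto (errorRatio f P x) (𝓝[>] 0) (𝓝 (ENNReal.ofReal (‖pairing η x‖ / γ))) := by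
    filter_upwards [uniformSphere_pairing_ne_zero (𝕜 := 𝕜) hη0,
      uniformSphere_norm_eq_one (V := MatPoly 𝕜 n d)] with x hx hx1
    have hne : sesq u (evalAt x z) v ≠ 0 := by
      rw [sesq_evalAt]
      exact mul_ne_zero (Complex.ofReal_ne_zero.2 hSpos.ne') hx
    have h := tendsto_errorRatio hP hz hu hv hf hne
    rw [hx1, div_one, sesq_evalAt, norm_mul, Complex.norm_real, Real.norm_of_nonneg hSpos.le] at h
    rw [hγdef, gammaP, div_div_eq_mul_div, mul_comm ‖pairing η x‖]
    exact h
  have hae := ae_of_ae_map hE.aemeasurable (hE.map_eq ▸ hlaw)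
  have hsens : ∀ᵐ ω ∂μ, directionalSensitivity f P (E ω) =
      ENNReal.ofReal (‖pairing η (E ω)‖ / γ) := by
    filter_upwards [hae] with ω hω using hω.limUnder_eq
  refine ⟨?_, fun t ht0 ht => ?_⟩
  · filter_upwards [hae, hsens] with ω h1 h2
    rwa [h2]
  -- The tail bound needs a positive level; at `t = 0` the right-hand side is 1.
  rcases ht0.eq_or_lt with rfl | htpos
  · simp
  -- `P` serves as the nonzero kernel vector that the real case `N = 2` requires.
  have hP0 : P ≠ 0 := fun h => sesq_derivAt_ne_zero hP hz hu hv (by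
    rw [h]; simp [derivAt, toMatrix, sesq, dotProduct, mulVec])
  have hpair : pairing η P = 0 := by
    have h := sesq_evalAt P z u v
    rw [sesq, hv.2, dotProduct_zero] at h
    exact (mul_eq_zero.1 h.symm).resolve_left (Complex.ofReal_ne_zero.2 hSpos.ne')
  have hγt : γ * t ≤ 1 := by
    calc γ * t ≤ γ * γ⁻¹ := mul_le_mul_of_nonneg_left ht hγ.le
      _ = 1 := mul_inv_cancel₀ hγ.ne'
  have hs : 0 < (γ * t) ^ 2 := by positivity
  have hs1 : (γ * t) ^ 2 ≤ 1 := pow_le_one₀ (by positivity) hγt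
  have hbound := uniformSphere_pairing_le hη1 hP0 hpair hs hs1
  set A : Set (MatPoly 𝕜 n d) := {x | (γ * t) ^ 2 ≤ ‖pairing η x‖ ^ 2} with hA
  have hAm : MeasurableSet A :=
    (isClosed_le continuous_const ((continuous_pairing η).norm.pow 2)).measurableSet
  have hsub : μ {ω | ENNReal.ofReal t ≤ directionalSensitivity f P (E ω)} ≤ μ (E ⁻¹' A) := by
    refine measure_mono_ae ?_
    filter_upwards [hsens] with ω hω hle
    have hle' : ENNReal.ofReal t ≤ directionalSensitivity f P (E ω) := hle
    rw [hω, ENNReal.ofReal_le_ofReal_iff (by positivity), le_div_iff₀ hγ] at hle'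
    change (γ * t) ^ 2 ≤ ‖pairing η (E ω)‖ ^ 2
    rw [mul_comm]
    exact pow_le_pow_left₀ (by positivity) hle' 2
  rw [← Measure.map_apply_of_aemeasurable hE.aemeasurable hAm, hE.map_eq] at hsub
  refine (ENNReal.toReal_mono ENNReal.ofReal_ne_top (hsub.trans hbound)).trans (le_of_eq ?_)
  rw [ENNReal.toReal_ofReal (Real.exp_pos _).le]
  congr 1
  simp only [Fintype.card_prod, Fintype.card_fin]
  push_cast
  ring
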